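/- Let $(M,g)$ be a smooth semi-Riemannian manifold ($g$ a smooth field of symmetric non-degenerate bilinear forms, of arbitrary signature) with Levi-Civita connection $\nabla$, and let $f:\tilde M\to M$ be an immersed submanifold, possibly degenerate (i.e. $f^*g$ may be degenerate). For vector fields $X,Y$ on $\tilde M$ define the second fundamental form at $p\in\tilde M$ by $\Pi(X,Y)_p=[\nabla_XY]_p\in T_{f(p)}M/df(T_p\tilde M)$, where $\nabla_XY$ is the covariant derivative along $f$. Call $\tilde M$ totally umbilic if there is a smooth vector field $N$ along $f$ (i.e. $N_p\in T_{f(p)}M$) such that $\Pi(X,Y)=[g(X,Y)N]$ for all smooth vector fields $X,Y$ on $\tilde M$, and totally geodesic if such an $N$ exists with $[N]=[0]$. A $\nabla$-geodesic is a smooth curve $\gamma:J\to M$ on an open interval $J$ with $\nabla_{\gamma'}\gamma'=0$; it is called lightlike if $g(\gamma',\gamma')=0$ on $J$ (constant curves are allowed). It starts tangentially to $\tilde M$ at the parameter $t_0\in J$ and the point $p\in\tilde M$ if $\gamma(t_0)=f(p)$ and $\gamma'(t_0)\in df(T_p\tilde M)$; it then remains within $\tilde M$ for some parameter interval around the starting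 point if there are $\varepsilon>0$ and a continuous curve $c:(t_0-\varepsilon,t_0+\varepsilon)\to\tilde M$ with $c(t_0)=p$ and $\gamma=f\circ c$ on that interval. Then: (a) If $\tilde M$ is totally umbilic, then every lightlike $\nabla$-geodesic that starts tangentially to $\tilde M$ remains within $\tilde M$ for some parameter interval around the starting point. (b) $\tilde M$ is totally geodesic if and only if every $\nabla$-geodesic that starts tangentially to $\tilde M$ remains within $\tilde M$ for some parameter interval around the starting point. -/

import Mathlib

open Bundle Set Manifold
open scoped Manifold ContDiff Topology

noncomputable section

/-- A (smooth) semi-Riemannian metric on a manifold `M` modelled on `E`: a smooth field of symmetric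
non-degenerate bilinear forms, of any signature, on the tangent spaces. -/
structure SemiRiemannianMetric (E : Type*) [NormedAddCommGroup E] [NormedSpace ℝ E]
    (M : Type*) [TopologicalSpace M] [ChartedSpace E M] [IsManifold 𝓘(ℝ, E) ∞ M] where
  /-- The bilinear form on the tangent space at `x`. -/
  form (x : M) : TangentSpace 𝓘(ℝ, E) x →L[ℝ] TangentSpace 𝓘(ℝ, E) x →L[ℝ] ℝ
  symm (x : M) (v w : TangentSpace 𝓘(ℝ, E) x) : form x v w = form x w v
  nondegenerate (x : M) (v : TangentSpace 𝓘(ℝ, E) x) (hv : ∀ w, form x v w = 0) : v = 0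
  contMDiff : ContMDiff 𝓘(ℝ, E) (𝓘(ℝ, E).prod 𝓘(ℝ, E →L[ℝ] E →L[ℝ] ℝ)) ∞
    (fun x ↦ TotalSpace.mk' (E →L[ℝ] E →L[ℝ] ℝ)
      (E := fun x : M ↦ TangentSpace 𝓘(ℝ, E) x →L[ℝ] TangentSpace 𝓘(ℝ, E) x →L[ℝ] ℝ) x (form x))

section

variable {E : Type*} [NormedAddCommGroup E] [NormedSpace ℝ E] [FiniteDimensional ℝ E]
  {M : Type*} [TopologicalSpace M] [ChartedSpace E M] [IsManifold 𝓘(ℝ, E) ∞ M]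
  {E' : Type*} [NormedAddCommGroup E'] [NormedSpace ℝ E']
  {S : Type*} [TopologicalSpace S] [ChartedSpace E' S]

/-- `cov` is the Levi-Civita connection of `g`: the smooth connection on the tangent bundle with
`∇_X Y - ∇_Y X = [X, Y]` and `X (g(Y, Z)) = g(∇_X Y, Z) + g(Y, ∇_X Z)`.
Here `cov Y x (X x)` is the value of `∇_X Y` at `x`. -/
structure IsLeviCivita (g : SemiRiemannianMetric E M)
    (cov : CovariantDerivative 𝓘(ℝ, E) E (TangentSpace 𝓘(ℝ, E) : M → Type _)) : Prop where
  smooth : CovariantDerivative.ContMDiffCovariantDerivative cov ∞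
  torsion_free : ∀ (X Y : Π x : M, TangentSpace 𝓘(ℝ, E) x) (x : M),
    MDiffAt (T% X) x → MDiffAt (T% Y) x →
      cov Y x (X x) - cov X x (Y x) = VectorField.mlieBracket 𝓘(ℝ, E) X Y x
  metric : ∀ (Y Z : Π x : M, TangentSpace 𝓘(ℝ, E) x) (x : M) (v : TangentSpace 𝓘(ℝ, E) x),
    MDiffAt (T% Y) x → MDiffAt (T% Z) x →
      mvfderiv 𝓘(ℝ, E) (fun y ↦ g.form y (Y y) (Z y)) x v =
        g.form x (cov Y x v) (Z x) + g.form x (Y x) (cov Z x v)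

/-- The covariant derivative `∇_v Z` at `p` of a vector field `Z` along a map `f : S → M`, in the
direction `v ∈ T_p S` (that is, the pulled-back connection `f^*∇`).
Let `e_i` be the coordinate frame of the preferred chart of `M` at `f p` and write
`Z q = ∑ i, Z^i(q) e_i(f q)` for `q` near `p`; then the value is
`∑ i, (dZ^i(v) e_i + Z^i(p) ∇_{df(v)} e_i)` at `f p`. The function `q ↦ (Z^i(q))_i` is `Z` read in the
trivialization of the tangent bundle given by the chart, and `∑ i, Z^i(p) e_i` is the extension
`FiberBundle.extend E (Z p)` of the vector `Z p` with constant coefficients. -/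
def covDerivAlong (cov : CovariantDerivative 𝓘(ℝ, E) E (TangentSpace 𝓘(ℝ, E) : M → Type _))
    (f : S → M) (Z : Π q : S, TangentSpace 𝓘(ℝ, E) (f q)) (p : S)
    (v : TangentSpace 𝓘(ℝ, E') p) : TangentSpace 𝓘(ℝ, E) (f p) :=
  (trivializationAt E (TangentSpace 𝓘(ℝ, E) : M → Type _) (f p)).symmL ℝ (f p)
      (mvfderiv 𝓘(ℝ, E') (fun q ↦ (trivializationAt E (TangentSpace 𝓘(ℝ, E) : M → Type _) (f p)
        (⟨f q, Z q⟩ : TangentBundle 𝓘(ℝ, E) M)).2) p v)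
    + cov (FiberBundle.extend E (Z p)) (f p) (mfderiv 𝓘(ℝ, E') 𝓘(ℝ, E) f p v)

/-! ### Immersed submanifolds `f : S → M` -/

/-- The tangent space of the immersed submanifold `f : S → M` at `p`, inside `T_{f p} M`. -/
def tangentImage (f : S → M) (p : S) : Submodule ℝ (TangentSpace 𝓘(ℝ, E) (f p)) :=
  LinearMap.range (mfderiv 𝓘(ℝ, E') 𝓘(ℝ, E) f p).toLinearMap

/-- The vector field `df(X)` along `f` that a vector field `X` on `S` defines. -/
def pushAlong (f : S → M) (X : Π q : S, TangentSpace 𝓘(ℝ, E') q) (q : S) :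
    TangentSpace 𝓘(ℝ, E) (f q) :=
  mfderiv 𝓘(ℝ, E') 𝓘(ℝ, E) f q (X q)

/-- The second fundamental form `Π(X, Y) = [∇_X Y]` at `p`, with values in `T_{f p} M / T_p S`. -/
def secondFundamentalForm
    (cov : CovariantDerivative 𝓘(ℝ, E) E (TangentSpace 𝓘(ℝ, E) : M → Type _))
    (f : S → M) (X Y : Π q : S, TangentSpace 𝓘(ℝ, E') q) (p : S) :
    TangentSpace 𝓘(ℝ, E) (f p) ⧸ tangentImage (E := E) (E' := E') f p :=
  Submodule.Quotient.mk (covDerivAlong cov f (pushAlong f Y) p (X p))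

/-- `N` is a smooth vector field along `f`, and `Π(X, Y) = [g(X, Y) N]` for all smooth vector fields
`X`, `Y` on `S`. -/
structure IsUmbilicWith (E' : Type*) [NormedAddCommGroup E'] [NormedSpace ℝ E']
    [ChartedSpace E' S] [IsManifold 𝓘(ℝ, E') ∞ S] (g : SemiRiemannianMetric E M)
    (cov : CovariantDerivative 𝓘(ℝ, E) E (TangentSpace 𝓘(ℝ, E) : M → Type _))
    (f : S → M) (N : Π q : S, TangentSpace 𝓘(ℝ, E) (f q)) : Prop where
  smooth : ContMDiff 𝓘(ℝ, E') 𝓘(ℝ, E).tangent ∞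
    (fun q ↦ (⟨f q, N q⟩ : TangentBundle 𝓘(ℝ, E) M))
  umbilic : ∀ X Y : Π q : S, TangentSpace 𝓘(ℝ, E') q,
    ContMDiff 𝓘(ℝ, E') 𝓘(ℝ, E').tangent ∞ (fun q ↦ (⟨q, X q⟩ : TangentBundle 𝓘(ℝ, E') S)) →
    ContMDiff 𝓘(ℝ, E') 𝓘(ℝ, E').tangent ∞ (fun q ↦ (⟨q, Y q⟩ : TangentBundle 𝓘(ℝ, E') S)) →
    ∀ p : S, secondFundamentalForm cov f X Y p =
      Submodule.Quotient.mk (g.form (f p) (pushAlong f X p) (pushAlong f Y p) • N p)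

/-- The immersed submanifold `f : S → M` is totally umbilic. -/
def IsTotallyUmbilic (E' : Type*) [NormedAddCommGroup E'] [NormedSpace ℝ E']
    [ChartedSpace E' S] [IsManifold 𝓘(ℝ, E') ∞ S] (g : SemiRiemannianMetric E M)
    (cov : CovariantDerivative 𝓘(ℝ, E) E (TangentSpace 𝓘(ℝ, E) : M → Type _))
    (f : S → M) : Prop :=
  ∃ N : Π q : S, TangentSpace 𝓘(ℝ, E) (f q), IsUmbilicWith E' g cov f N

/-- The immersed submanifold `f : S → M` is totally geodesic: it is totally umbilic with
`[N] = [0]`. -/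
def IsTotallyGeodesic (E' : Type*) [NormedAddCommGroup E'] [NormedSpace ℝ E']
    [ChartedSpace E' S] [IsManifold 𝓘(ℝ, E') ∞ S] (g : SemiRiemannianMetric E M)
    (cov : CovariantDerivative 𝓘(ℝ, E) E (TangentSpace 𝓘(ℝ, E) : M → Type _))
    (f : S → M) : Prop :=
  ∃ N : Π q : S, TangentSpace 𝓘(ℝ, E) (f q), IsUmbilicWith E' g cov f N ∧
    ∀ q : S, (Submodule.Quotient.mk (N q) :
      TangentSpace 𝓘(ℝ, E) (f q) ⧸ tangentImage (E := E) (E' := E') f q) = 0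

/-! ### Curves -/

/-- The velocity vector `γ'(t)`. -/
def velocity (γ : ℝ → M) (t : ℝ) : TangentSpace 𝓘(ℝ, E) (γ t) :=
  mfderiv 𝓘(ℝ, ℝ) 𝓘(ℝ, E) γ t (1 : ℝ)

/-- `γ` is a geodesic on the open set `J ⊆ ℝ`: it is smooth there and `∇_{γ'} γ' = 0`, where the
covariant derivative is taken along `γ`. -/
structure IsGeodesicOn (cov : CovariantDerivative 𝓘(ℝ, E) E (TangentSpace 𝓘(ℝ, E) : M → Type _))
    (γ : ℝ → M) (J : Set ℝ) : Prop where
  smooth : ContMDiffOn 𝓘(ℝ, ℝ) 𝓘(ℝ, E) ∞ γ J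
  geodesic : ∀ t ∈ J, covDerivAlong (E' := ℝ) cov γ (velocity γ) t (1 : ℝ) = 0

/-- The velocity of `γ` is lightlike (or zero) at all parameters in `J`. -/
def IsLightlikeOn (g : SemiRiemannianMetric E M) (γ : ℝ → M) (J : Set ℝ) : Prop :=
  ∀ t ∈ J, g.form (γ t) (velocity γ t) (velocity γ t) = 0

/-- `γ` starts at the parameter `t₀` tangentially to the immersed submanifold `f : S → M`, at the
point `p` of `S`: `γ(t₀) = f(p)`, and `γ'(t₀) = df(v)` for some `v ∈ T_p S`. -/
def StartsTangentAt (E E' : Type*) [NormedAddCommGroup E] [NormedSpace ℝ E]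
    [ChartedSpace E M] [NormedAddCommGroup E'] [NormedSpace ℝ E'] [ChartedSpace E' S]
    (f : S → M) (p : S) (γ : ℝ → M) (t₀ : ℝ) : Prop :=
  ∃ v : TangentSpace 𝓘(ℝ, E') p,
    (⟨γ t₀, velocity γ t₀⟩ : TangentBundle 𝓘(ℝ, E) M) = ⟨f p, mfderiv 𝓘(ℝ, E') 𝓘(ℝ, E) f p v⟩

/-- `γ` remains, for parameters near `t₀`, within the immersed submanifold `f : S → M`: near `t₀` it is
the image of a continuous curve in `S` through `p`. -/
def RemainsWithinNear (f : S → M) (p : S) (γ : ℝ → M) (t₀ : ℝ) : Prop :=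
  ∃ ε > 0, ∃ c : ℝ → S, ContinuousOn c (Ioo (t₀ - ε) (t₀ + ε)) ∧ c t₀ = p ∧
    ∀ t ∈ Ioo (t₀ - ε) (t₀ + ε), f (c t) = γ t

end

end

/-! An immersion has charts in which it is a linear embedding `ι` with a linear left inverse `P`.
Let `Γ` be the Christoffel symbols and `G` the coordinate metric. Differentiating a tangential field
in these charts produces a term in `range ι`, so modulo tangent vectors only the `Γ` term survives.
Umbilicity therefore says that `Γ(ιv, ιv) - G(ιv, ιv) n` lies in `range ι`.

To show that a geodesic stays inside, solve the projected equation `u'' = -P Γ(ιu', ιu')` with the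
same initial data (`exists_eventually_eq_of_geodesic`). The curve `X = ιu` with velocity `Y = ιu'`
satisfies `Y' = -Γ(Y, Y) + G(Y, Y) m`, where `m = n - ιPn`. Since `G` is parallel, `h = G(Y, Y)`
solves the linear equation `h' = (G(m, Y) + G(Y, m)) h`. It starts at zero, hence vanishes, so `X`
is a geodesic and by uniqueness it is the given one. This needs no nondegeneracy of the induced
form. For (a), `G` is the metric; for the forward half of (b), `G = 0` and `n = 0`, so that no null
condition remains.

For the converse in (b), apply `1 - ιP` to a geodesic with initial velocity `ιv` and differentiate
twice: `Γ(ιv, ιv)` lies in `range ι` (`christoffel_mem_of_remainsWithinNear`). Torsion-freeness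
makes `Γ` symmetric, and polarization kills the second fundamental form. -/

noncomputable section

/-! ### Geodesic equations on vector spaces -/

section GeodesicEquation

variable {E : Type*} [NormedAddCommGroup E] [NormedSpace ℝ E]
  {E' : Type*} [NormedAddCommGroup E'] [NormedSpace ℝ E']

/-- The geodesic spray `(x, y) ↦ (y, -Γ(x)(y, y))` of a field `Γ` of bilinear maps. -/
def geodesicSpray (Γ : E → E →L[ℝ] E →L[ℝ] E) (z : E × E) : E × E := (z.2, -Γ z.1 z.2 z.2)

lemma contDiffAt_geodesicSpray {Γ : E → E →L[ℝ] E →L[ℝ] E} {n : WithTop ℕ∞} {z : E × E}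
    (hΓ : ContDiffAt ℝ n Γ z.1) : ContDiffAt ℝ n (geodesicSpray Γ) z := by
  have h : ContDiffAt ℝ n (fun z : E × E ↦ Γ z.1) z := hΓ.comp z contDiffAt_fst
  exact contDiffAt_snd.prodMk ((h.clm_apply contDiffAt_snd).clm_apply contDiffAt_snd).neg

/-- Local uniqueness for a `C^1` autonomous ODE. -/
lemma ContDiffAt.eventuallyEq_of_hasDerivAt {F : E → E} {a b : ℝ → E} {t₀ : ℝ}
    (hF : ContDiffAt ℝ 1 F (a t₀)) (ha : ∀ᶠ t in 𝓝 t₀, HasDerivAt a (F (a t)) t)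
    (hb : ∀ᶠ t in 𝓝 t₀, HasDerivAt b (F (b t)) t) (h : a t₀ = b t₀) : a =ᶠ[𝓝 t₀] b := by
  obtain ⟨K, s, hs, hK⟩ := hF.exists_lipschitzOnWith
  have hac : ContinuousAt a t₀ := ha.self_of_nhds.continuousAt
  have hbc : ContinuousAt b t₀ := hb.self_of_nhds.continuousAt
  exact ODE_solution_unique_of_eventually (v := fun _ ↦ F) (s := fun _ ↦ s)
    (Filter.Eventually.of_forall fun _ ↦ hK) (ha.and (hac hs)) (hb.and (hbc (h ▸ hs))) h

/-- A solution of a linear ODE with bounded coefficient that vanishes at one point vanishes near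
this point. -/
lemma eventually_eq_zero_of_hasDerivAt_mul {h a : ℝ → ℝ} {t₀ : ℝ} (ha : ContinuousAt a t₀)
    (hh : ∀ᶠ t in 𝓝 t₀, HasDerivAt h (a t * h t) t) (h0 : h t₀ = 0) : ∀ᶠ t in 𝓝 t₀, h t = 0 := by
  -- By continuity `|a|` stays below `|a t₀| + 1` near `t₀`, which gives one Lipschitz constant for
  -- all these times.
  have hK : ∀ᶠ t in 𝓝 t₀, LipschitzOnWith ⟨|a t₀| + 1, by positivity⟩ (fun y ↦ a t * y) univ := by
    filter_upwards [ha.abs.eventually_lt_const (lt_add_one |a t₀|)] with t ht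
    refine (LipschitzWith.of_dist_le_mul fun x y ↦ ?_).lipschitzOnWith
    rw [Real.dist_eq, Real.dist_eq, ← mul_sub, abs_mul]
    exact mul_le_mul_of_nonneg_right ht.le (abs_nonneg _)
  refine ODE_solution_unique_of_eventually (v := fun t y ↦ a t * y) (g := fun _ ↦ 0)
    hK (hh.mono fun t ht ↦ ⟨ht, mem_univ _⟩)
      (Filter.Eventually.of_forall fun t ↦ ⟨?_, mem_univ _⟩) h0
  simpa using hasDerivAt_const t (0 : ℝ)

/-- The derivative of `G(x)(y, y)` along a curve. -/
lemma HasDerivAt.bilinForm_apply {G : E → E →L[ℝ] E →L[ℝ] ℝ} {x y : ℝ → E} {x' y' : E} {t : ℝ}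
    (hx : HasDerivAt x x' t) (hG : DifferentiableAt ℝ G (x t)) (hy : HasDerivAt y y' t) :
    HasDerivAt (fun t ↦ G (x t) (y t) (y t))
      (fderiv ℝ G (x t) x' (y t) (y t) + G (x t) y' (y t) + G (x t) (y t) y') t := by
  have h1 : HasDerivAt (G ∘ x) (fderiv ℝ G (x t) x') t :=
    HasFDerivAt.comp_hasDerivAt (E := E →L[ℝ] E →L[ℝ] ℝ) t hG.hasFDerivAt hx
  have h2 := HasDerivAt.clm_apply (c := G ∘ x) h1 hy
  refine (HasDerivAt.clm_apply h2 hy).congr_deriv ?_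
  simp only [_root_.add_apply, Function.comp_apply]

/-- Let `Γ` be a connection on a vector space and `ι` a linear embedding of another vector space
such that, near `u₀`, the second fundamental form of `ι` is `G(v, v) n`, with `G` parallel for `Γ`.
Then a geodesic that starts tangentially in a `G`-null direction remains in the image of `ι`. -/
theorem exists_eventually_eq_of_geodesic [CompleteSpace E']
    {Γ : E → E →L[ℝ] E →L[ℝ] E} {G : E → E →L[ℝ] E →L[ℝ] ℝ} {ι : E' →L[ℝ] E} {P : E →L[ℝ] E'}
    (hP : ∀ u, P (ι u) = u) {n : E' → E} {u₀ v₀ : E'} {x y : ℝ → E} {t₀ : ℝ}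
    (hΓ : ContDiffAt ℝ 1 Γ (ι u₀)) (hn : ContinuousAt n u₀)
    (hG : ∀ᶠ z in 𝓝 (ι u₀), DifferentiableAt ℝ G z ∧
      ∀ u v w, fderiv ℝ G z u v w = G z (Γ z u v) w + G z v (Γ z u w))
    (hG₀ : ContinuousAt G (ι u₀))
    (humb : ∀ᶠ u in 𝓝 u₀, ∀ v,
      Γ (ι u) (ι v) (ι v) - G (ι u) (ι v) (ι v) • n u ∈ range ι)
    (hnull : G (ι u₀) (ι v₀) (ι v₀) = 0)
    (hx : ∀ᶠ t in 𝓝 t₀, HasDerivAt x (y t) t)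
    (hy : ∀ᶠ t in 𝓝 t₀, HasDerivAt y (-Γ (x t) (y t) (y t)) t)
    (hx₀ : x t₀ = ι u₀) (hy₀ : y t₀ = ι v₀) :
    ∃ u : ℝ → E', (∀ᶠ t in 𝓝 t₀, ContinuousAt u t) ∧ u t₀ = u₀ ∧ ∀ᶠ t in 𝓝 t₀, ι (u t) = x t := by
  -- The spray on `E'` obtained by projecting the ambient one with `P`.
  have hF : ContDiffAt ℝ 1
      (fun z : E' × E' ↦ (z.2, -P (Γ (ι z.1) (ι z.2) (ι z.2)))) (u₀, v₀) := by
    have h1 : ContDiffAt ℝ 1 (fun z : E' × E' ↦ Γ (ι z.1)) (u₀, v₀) :=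
      ContDiffAt.comp (f := fun z : E' × E' ↦ ι z.1) (u₀, v₀) hΓ
        (ι.contDiff.contDiffAt.comp _ contDiffAt_fst)
    have h2 : ContDiffAt ℝ 1 (fun z : E' × E' ↦ ι z.2) (u₀, v₀) :=
      ι.contDiff.contDiffAt.comp _ contDiffAt_snd
    exact contDiffAt_snd.prodMk
      (P.contDiff.contDiffAt.comp _ ((h1.clm_apply h2).clm_apply h2)).neg
  obtain ⟨α, hα₀, ε, hε, hα⟩ :=
    hF.exists_forall_mem_closedBall_exists_eq_forall_mem_Ioo_hasDerivAt₀ t₀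
  have hα' : ∀ᶠ t in 𝓝 t₀, HasDerivAt α
      ((α t).2, -P (Γ (ι (α t).1) (ι (α t).2) (ι (α t).2))) t :=
    Filter.eventually_of_mem (Ioo_mem_nhds (by linarith) (by linarith)) hα
  have hαc : ContinuousAt α t₀ := hα'.self_of_nhds.continuousAt
  have hu : ∀ᶠ t in 𝓝 t₀, HasDerivAt (fun t ↦ ι (α t).1) (ι (α t).2) t :=
    hα'.mono fun t ht ↦ ι.hasFDerivAt.comp_hasDerivAt t ht.fst
  have hv : ∀ᶠ t in 𝓝 t₀, HasDerivAt (fun t ↦ ι (α t).2)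
      (ι (-P (Γ (ι (α t).1) (ι (α t).2) (ι (α t).2)))) t :=
    hα'.mono fun t ht ↦ ι.hasFDerivAt.comp_hasDerivAt t ht.snd
  set X : ℝ → E := fun t ↦ ι (α t).1 with hX
  set Y : ℝ → E := fun t ↦ ι (α t).2 with hY
  have hXc : ContinuousAt X t₀ := ι.continuous.continuousAt.comp hαc.fst
  have hYc : ContinuousAt Y t₀ := ι.continuous.continuousAt.comp hαc.snd
  have hX₀ : X t₀ = ι u₀ := by simp [hX, hα₀]
  have hY₀ : Y t₀ = ι v₀ := by simp [hY, hα₀]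
  have hα₁ : (α t₀).1 = u₀ := by rw [hα₀]
  -- The component of `n` in `ker P`; its tangential part is absorbed by the projection.
  set m : E' → E := fun u ↦ n u - ι (P (n u)) with hm
  have hmc : ContinuousAt (fun t ↦ m (α t).1) t₀ := by
    have h : ContinuousAt (fun t ↦ n (α t).1) t₀ :=
      ContinuousAt.comp (f := fun t ↦ (α t).1) (hα₁ ▸ hn) hαc.fst
    exact h.sub (ι.continuous.continuousAt.comp (P.continuous.continuousAt.comp h))
  have hacc : ∀ᶠ t in 𝓝 t₀, ι (-P (Γ (X t) (Y t) (Y t))) =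
      -Γ (X t) (Y t) (Y t) + G (X t) (Y t) (Y t) • m (α t).1 := by
    have h := hαc.fst.eventually (hα₁.symm ▸ humb)
    filter_upwards [h] with t ht
    obtain ⟨w, hw⟩ := ht (α t).2
    have h1 : Γ (X t) (Y t) (Y t) = ι w + G (X t) (Y t) (Y t) • n (α t).1 := by
      rw [hw]; simp [hX, hY]
    rw [h1]
    simp only [map_neg, map_add, map_smul, hP, hm]
    module
  have hGX : ContinuousAt (fun t ↦ G (X t)) t₀ :=
    ContinuousAt.comp (f := X) (hX₀ ▸ hG₀) hXc
  -- Parallelism of `G` cancels both `Γ` terms of the derivative. What remains carries the factor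
  -- `G(Y, Y)`, so the equation is linear and homogeneous. Symmetry of `G` is not needed.
  have hnullX : ∀ᶠ t in 𝓝 t₀, G (X t) (Y t) (Y t) = 0 := by
    refine eventually_eq_zero_of_hasDerivAt_mul
      (a := fun t ↦ G (X t) (m (α t).1) (Y t) + G (X t) (Y t) (m (α t).1)) ?_ ?_ ?_
    · exact ((hGX.clm_apply hmc).clm_apply hYc).add ((hGX.clm_apply hYc).clm_apply hmc)
    · have hG' := hXc.eventually (hX₀.symm ▸ hG)
      filter_upwards [hu, hv, hacc, hG'] with t hXt hYt hat hGt
      rw [hat] at hYt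
      refine (hXt.bilinForm_apply hGt.1 hYt).congr_deriv ?_
      rw [hGt.2]
      generalize G (X t) = B
      generalize Γ (X t) (Y t) (Y t) = w
      simp only [map_add, map_neg, map_smul, _root_.add_apply,
        _root_.neg_apply, _root_.smul_apply, smul_eq_mul]
      ring
    · simp only [hX₀, hY₀, hnull]
  have hXY : (fun t ↦ (x t, y t)) =ᶠ[𝓝 t₀] fun t ↦ (X t, Y t) := by
    refine ContDiffAt.eventuallyEq_of_hasDerivAt (F := geodesicSpray Γ)
      (contDiffAt_geodesicSpray (by simpa [hx₀] using hΓ)) ?_ ?_ ?_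
    · filter_upwards [hx, hy] with t h1 h2 using h1.prodMk h2
    · filter_upwards [hu, hv, hacc, hnullX] with t h1 h2 h3 h4
      rw [h3, h4, zero_smul, add_zero] at h2
      exact h1.prodMk h2
    · simp [hx₀, hy₀, hX₀, hY₀]
  refine ⟨fun t ↦ (α t).1, hα'.mono fun t ht ↦ ht.continuousAt.fst, hα₁, ?_⟩
  filter_upwards [hXY] with t ht using (congrArg Prod.fst ht).symm

/-- Solutions of a smooth autonomous ODE are smooth. -/
lemma contDiffOn_of_hasDerivAt {F : E → E} {U : Set E} {α : ℝ → E} {s : Set ℝ} (hs : IsOpen s)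
    (hF : ContDiffOn ℝ ∞ F U) (hU : MapsTo α s U)
    (hα : ∀ t ∈ s, HasDerivAt α (F (α t)) t) : ContDiffOn ℝ ∞ α s := by
  rw [contDiffOn_infty]
  intro n
  induction n with
  | zero => exact contDiffOn_zero.2 fun t ht ↦ (hα t ht).continuousAt.continuousWithinAt
  | succ n ih =>
    rw [Nat.cast_add, Nat.cast_one, contDiffOn_succ_iff_deriv_of_isOpen hs]
    refine ⟨fun t ht ↦ (hα t ht).differentiableAt.differentiableWithinAt, by simp, ?_⟩
    exact ((hF.of_le (by exact_mod_cast le_top)).comp ih hU).congr fun t ht ↦ (hα t ht).deriv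

/-- Local existence of geodesics of a connection on an open subset of a vector space. -/
theorem exists_geodesic_of_contDiffOn [CompleteSpace E] {Γ : E → E →L[ℝ] E →L[ℝ] E} {U : Set E}
    (hU : IsOpen U) (hΓ : ContDiffOn ℝ ∞ Γ U) {x₀ : E} (hx₀ : x₀ ∈ U) (y₀ : E) (t₀ : ℝ) :
    ∃ x y : ℝ → E, ∃ ε > 0, x t₀ = x₀ ∧ y t₀ = y₀ ∧
      ContDiffOn ℝ ∞ x (Ioo (t₀ - ε) (t₀ + ε)) ∧
      ∀ t ∈ Ioo (t₀ - ε) (t₀ + ε), x t ∈ U ∧ HasDerivAt x (y t) t ∧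
        HasDerivAt y (-Γ (x t) (y t) (y t)) t := by
  have hF : ContDiffOn ℝ ∞ (geodesicSpray Γ) (U ×ˢ univ) := fun z hz ↦
    (contDiffAt_geodesicSpray (hΓ.contDiffAt (hU.mem_nhds hz.1))).contDiffWithinAt
  have hF₀ : ContDiffAt ℝ 1 (geodesicSpray Γ) (x₀, y₀) :=
    (hF.contDiffAt ((hU.prod isOpen_univ).mem_nhds ⟨hx₀, mem_univ _⟩)).of_le (by simp)
  obtain ⟨α, hα₀, ε, hε, hα⟩ :=
    hF₀.exists_forall_mem_closedBall_exists_eq_forall_mem_Ioo_hasDerivAt₀ t₀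
  have hαc : ContinuousAt α t₀ := (hα t₀ ⟨by linarith, by linarith⟩).continuousAt
  have hmem : ∀ᶠ t in 𝓝 t₀, (α t).1 ∈ U :=
    hαc.fst.eventually (hU.mem_nhds (by simpa [hα₀] using hx₀))
  obtain ⟨δ, hδ, hδU⟩ := Metric.eventually_nhds_iff_ball.1 hmem
  rw [Real.ball_eq_Ioo] at hδU
  -- `ε` bounds the time of existence and `δ` the time during which the position stays in `U`.
  have hsub : Ioo (t₀ - min ε δ) (t₀ + min ε δ) ⊆ Ioo (t₀ - ε) (t₀ + ε) :=
    Ioo_subset_Ioo (by linarith [min_le_left ε δ]) (by linarith [min_le_left ε δ])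
  have hsub' : Ioo (t₀ - min ε δ) (t₀ + min ε δ) ⊆ Ioo (t₀ - δ) (t₀ + δ) :=
    Ioo_subset_Ioo (by linarith [min_le_right ε δ]) (by linarith [min_le_right ε δ])
  refine ⟨fun t ↦ (α t).1, fun t ↦ (α t).2, min ε δ, lt_min hε hδ, by simp [hα₀],
    by simp [hα₀], ?_, ?_⟩
  · exact (contDiffOn_of_hasDerivAt isOpen_Ioo hF
      (fun t ht ↦ ⟨hδU t (hsub' ht), mem_univ _⟩) fun t ht ↦ hα t (hsub ht)).fst
  · exact fun t ht ↦ ⟨hδU t (hsub' ht), (hα t (hsub ht)).fst, (hα t (hsub ht)).snd⟩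

end GeodesicEquation

/-! ### Coordinate vectors and coordinate fields -/

section ChartFields

variable {E : Type*} [NormedAddCommGroup E] [NormedSpace ℝ E]
  {M : Type*} [TopologicalSpace M] [ChartedSpace E M]

/-- The coordinate vector, in the chart `φ`, of a tangent vector. -/
def chartVec (φ : OpenPartialHomeomorph M E) (v : TangentBundle 𝓘(ℝ, E) M) : E :=
  mfderiv 𝓘(ℝ, E) 𝓘(ℝ, E) φ v.1 v.2

/-- The vector field on the domain of the chart `φ` with constant coordinates `z`. -/
def chartField (φ : OpenPartialHomeomorph M E) (z : E) (x : M) : TangentSpace 𝓘(ℝ, E) x :=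
  VectorField.mpullback 𝓘(ℝ, E) 𝓘(ℝ, E) φ (fun _ ↦ z) x

variable {φ : OpenPartialHomeomorph M E}

lemma chartField_add (z w : E) : chartField φ (z + w) = chartField φ z + chartField φ w := by
  ext x; exact (mfderiv 𝓘(ℝ, E) 𝓘(ℝ, E) φ x).inverse.map_add z w

lemma chartField_smul (c : ℝ) (z : E) : chartField φ (c • z) = c • chartField φ z := by
  ext x; exact (mfderiv 𝓘(ℝ, E) 𝓘(ℝ, E) φ x).inverse.map_smul c z

variable (hφ : φ ∈ IsManifold.maximalAtlas 𝓘(ℝ, E) ∞ M)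
include hφ

lemma mdifferentiable_of_mem_maximalAtlas : φ.MDifferentiable 𝓘(ℝ, E) 𝓘(ℝ, E) :=
  ⟨(contMDiffOn_of_mem_maximalAtlas hφ).mdifferentiableOn (by simp),
    (contMDiffOn_symm_of_mem_maximalAtlas hφ).mdifferentiableOn (by simp)⟩

lemma isInvertible_mfderiv_of_mem_maximalAtlas {x : M} (hx : x ∈ φ.source) :
    (mfderiv 𝓘(ℝ, E) 𝓘(ℝ, E) φ x).IsInvertible :=
  ⟨(mdifferentiable_of_mem_maximalAtlas hφ).mfderiv hx, rfl⟩

lemma chartVec_chartField {x : M} (hx : x ∈ φ.source) (z : E) :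
    chartVec φ ⟨x, chartField φ z x⟩ = z :=
  (isInvertible_mfderiv_of_mem_maximalAtlas hφ hx).self_apply_inverse z

lemma chartField_chartVec {x : M} (hx : x ∈ φ.source) (v : TangentSpace 𝓘(ℝ, E) x) :
    chartField φ (chartVec φ ⟨x, v⟩) x = v :=
  (isInvertible_mfderiv_of_mem_maximalAtlas hφ hx).inverse_apply_self v

variable [IsManifold 𝓘(ℝ, E) ∞ M]

/-- This is the fibre component of the tangent map of `φ`. Smoothness on the tangent bundle itself
covers fields along `f` as well as fields on a manifold. -/
lemma contMDiffAt_chartVec {v : TangentBundle 𝓘(ℝ, E) M} (hv : v.1 ∈ φ.source) :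
    ContMDiffAt 𝓘(ℝ, E).tangent 𝓘(ℝ, E) ∞ (chartVec φ) v := by
  have h1 := (contMDiffOn_of_mem_maximalAtlas hφ).contMDiffOn_tangentMapWithin (m := ∞) (by simp)
    φ.open_source.uniqueMDiffOn
  have hU : (TotalSpace.proj ⁻¹' φ.source : Set (TangentBundle 𝓘(ℝ, E) M)) ∈ 𝓝 v :=
    (FiberBundle.continuous_proj E (TangentSpace 𝓘(ℝ, E) : M → Type _)).continuousAt
      (φ.open_source.mem_nhds hv)
  have h2 := (contMDiff_snd_tangentBundle_modelSpace (n := ∞) E 𝓘(ℝ, E)).contMDiffAt.comp v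
    (h1.contMDiffAt hU)
  refine h2.congr_of_eventuallyEq ?_
  filter_upwards [hU] with w hw
  exact congrArg (fun L : E →L[ℝ] E ↦ L w.2)
    (mfderivWithin_of_isOpen (I := 𝓘(ℝ, E)) (I' := 𝓘(ℝ, E)) (f := φ) φ.open_source hw).symm

variable [CompleteSpace E]

lemma contMDiffAt_chartField {x : M} (hx : x ∈ φ.source) (z : E) :
    ContMDiffAt 𝓘(ℝ, E) 𝓘(ℝ, E).tangent ∞
      (fun x ↦ (⟨x, chartField φ z x⟩ : TangentBundle 𝓘(ℝ, E) M)) x := by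
  refine ContMDiffAt.mpullback_vectorField_preimage ?_ (contMDiffAt_of_mem_maximalAtlas hφ hx)
    (isInvertible_mfderiv_of_mem_maximalAtlas hφ hx) (by simp)
  exact contMDiffAt_vectorSpace_iff_contDiffAt.2 contDiffAt_const

lemma mdifferentiableAt_chartField {x : M} (hx : x ∈ φ.source) (z : E) :
    MDiffAt (T% (chartField φ z)) x :=
  (contMDiffAt_chartField hφ hx z).mdifferentiableAt (by simp)

/-- Lie brackets commute with pullback, and constant fields on a vector space commute. -/
lemma mlieBracket_chartField {x : M} (hx : x ∈ φ.source) (z w : E) :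
    VectorField.mlieBracket 𝓘(ℝ, E) (chartField φ z) (chartField φ w) x = 0 := by
  have two_le : (2 : WithTop ℕ∞) ≤ ∞ := WithTop.coe_le_coe.2 le_top
  have : IsManifold 𝓘(ℝ, E) (minSmoothness ℝ 2) M := by
    rw [minSmoothness_of_isRCLikeNormedField]
    exact IsManifold.of_le (n := ∞) two_le
  have hz (z : E) (y : E) : MDifferentiableAt 𝓘(ℝ, E) 𝓘(ℝ, E).tangent
      (fun y : E ↦ (⟨y, z⟩ : TangentBundle 𝓘(ℝ, E) E)) y :=
    (contMDiffAt_vectorSpace_iff_contDiffAt.2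
      (contDiffAt_const (n := 1))).mdifferentiableAt one_ne_zero
  have h := VectorField.mpullback_mlieBracket (hz z (φ x)) (hz w (φ x))
    (contMDiffAt_of_mem_maximalAtlas hφ hx)
    (by rwa [minSmoothness_of_isRCLikeNormedField])
  refine h.symm.trans ?_
  rw [VectorField.mpullback_apply]
  have h0 : VectorField.mlieBracket 𝓘(ℝ, E) (fun _ : E ↦ (z : E)) (fun _ : E ↦ (w : E)) (φ x) = 0 := by
    let V (z : E) : Π y : E, TangentSpace 𝓘(ℝ, E) y := fun _ ↦ z
    refine (congrFun (VectorField.mlieBracketWithin_univ (I := 𝓘(ℝ, E)) (V := V z) (W := V w))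
      (φ x)).symm.trans ((congrFun (VectorField.mlieBracketWithin_eq_lieBracketWithin (𝕜 := ℝ)
      (V := V z) (W := V w) (s := univ)) (φ x)).trans ?_)
    simp [VectorField.lieBracketWithin, V]; rfl
  exact (congrArg _ h0).trans (map_zero _)

end ChartFields

/-! ### Covariant derivatives in an arbitrary chart -/

section ChartFormula

variable {E : Type*} [NormedAddCommGroup E] [NormedSpace ℝ E]
  {M : Type*} [TopologicalSpace M] [ChartedSpace E M]
  {E' : Type*} [NormedAddCommGroup E'] [NormedSpace ℝ E']
  {S : Type*} [TopologicalSpace S] [ChartedSpace E' S]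

lemma mvfderiv_comp_fderiv {V W : Type*} [NormedAddCommGroup V] [NormedSpace ℝ V]
    [NormedAddCommGroup W] [NormedSpace ℝ W] {g : V → W} {h : S → V} {p : S}
    (hg : DifferentiableAt ℝ g (h p)) (hh : MDifferentiableAt 𝓘(ℝ, E') 𝓘(ℝ, V) h p)
    (v : TangentSpace 𝓘(ℝ, E') p) :
    mvfderiv 𝓘(ℝ, E') (fun q ↦ g (h q)) p v = fderiv ℝ g (h p) (mvfderiv 𝓘(ℝ, E') h p v) := by
  have h1 := (hg.hasFDerivAt.hasMFDerivAt.comp p hh.hasMFDerivAt).mfderiv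
  exact congrArg (fun L : E' →L[ℝ] W ↦ L v) h1

lemma Filter.EventuallyEq.mvfderiv_apply_eq {V : Type*} [NormedAddCommGroup V] [NormedSpace ℝ V]
    {g h : S → V} {p : S} (e : g =ᶠ[𝓝 p] h) (v : TangentSpace 𝓘(ℝ, E') p) :
    mvfderiv 𝓘(ℝ, E') g p v = mvfderiv 𝓘(ℝ, E') h p v :=
  congrArg (fun L : E' →L[ℝ] V ↦ L v) e.mfderiv_eq

variable [FiniteDimensional ℝ E] [IsManifold 𝓘(ℝ, E) ∞ M]
  (cov : CovariantDerivative 𝓘(ℝ, E) E (TangentSpace 𝓘(ℝ, E) : M → Type _))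

/-- In the trivialization of the tangent bundle given by the preferred chart at `x`, a connection is
the derivative of the coordinates plus a term that depends on the value at `x` only. -/
lemma cov_trivializationAt {x : M} {Y : Π x : M, TangentSpace 𝓘(ℝ, E) x} (hY : MDiffAt (T% Y) x)
    (w : TangentSpace 𝓘(ℝ, E) x) :
    cov Y x w = (trivializationAt E (TangentSpace 𝓘(ℝ, E) : M → Type _) x).symmL ℝ x
        (mvfderiv 𝓘(ℝ, E) (fun y ↦ (trivializationAt E (TangentSpace 𝓘(ℝ, E) : M → Type _) x
          (⟨y, Y y⟩ : TangentBundle 𝓘(ℝ, E) M)).2) x w)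
      + cov (FiberBundle.extend E (Y x)) x w := by
  have : IsManifold 𝓘(ℝ, E) 2 M := IsManifold.of_le (n := ∞) (WithTop.coe_le_coe.2 le_top)
  set T := trivializationAt E (TangentSpace 𝓘(ℝ, E) : M → Type _) x with hT
  have hx : x ∈ T.baseSet := FiberBundle.mem_baseSet_trivializationAt' x
  have hbase : ∀ᶠ y in 𝓝 x, y ∈ T.baseSet := T.open_baseSet.mem_nhds hx
  have hdiff {Y : Π x : M, TangentSpace 𝓘(ℝ, E) x} (hY : MDiffAt (T% Y) x) :
      MDifferentiableAt 𝓘(ℝ, E) 𝓘(ℝ, E)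
        (fun y ↦ (T (⟨y, Y y⟩ : TangentBundle 𝓘(ℝ, E) M)).2) x :=
    (T.mdifferentiableAt_section_iff 𝓘(ℝ, E) Y hx).1 hY
  -- Connection minus coordinate derivative: the Leibniz terms cancel, so the difference depends
  -- only on the value at `x`. It can be evaluated on the extension with constant coordinates.
  have htens : TensorialAt 𝓘(ℝ, E) E (fun Y : Π x : M, TangentSpace 𝓘(ℝ, E) x ↦
      cov Y x w - T.symmL ℝ x (mvfderiv 𝓘(ℝ, E)
        (fun y ↦ (T (⟨y, Y y⟩ : TangentBundle 𝓘(ℝ, E) M)).2) x w)) x := by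
    constructor
    · intro a σ ha hσ
      have e : (fun y ↦ (T (⟨y, (a • σ) y⟩ : TangentBundle 𝓘(ℝ, E) M)).2) =ᶠ[𝓝 x]
          a • fun y ↦ (T (⟨y, σ y⟩ : TangentBundle 𝓘(ℝ, E) M)).2 := by
        filter_upwards [hbase] with y hy
        exact (T.linear ℝ hy).map_smul (a y) (σ y)
      rw [e.mvfderiv_apply_eq, mvfderiv_smul ha (hdiff hσ),
        cov.isCovariantDerivativeOnUniv.leibniz hσ ha]
      simp only [_root_.add_apply, _root_.smul_apply, ContinuousLinearMap.smulRight_apply, map_add,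
        map_smul]
      have h1 : T.symmL ℝ x ((T (⟨x, σ x⟩ : TangentBundle 𝓘(ℝ, E) M)).2) = σ x := by
        simp [T.symmL_apply, hx]
      rw [h1]
      module
    · intro σ σ' hσ hσ'
      have e : (fun y ↦ (T (⟨y, (σ + σ') y⟩ : TangentBundle 𝓘(ℝ, E) M)).2) =ᶠ[𝓝 x]
          (fun y ↦ (T (⟨y, σ y⟩ : TangentBundle 𝓘(ℝ, E) M)).2) +
            fun y ↦ (T (⟨y, σ' y⟩ : TangentBundle 𝓘(ℝ, E) M)).2 := by
        filter_upwards [hbase] with y hy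
        exact (T.linear ℝ hy).map_add (σ y) (σ' y)
      rw [e.mvfderiv_apply_eq, mvfderiv_add (hdiff hσ) (hdiff hσ'),
        cov.isCovariantDerivativeOnUniv.add hσ hσ']
      simp only [_root_.add_apply, map_add]
      abel
  have hext : MDiffAt (T% (FiberBundle.extend E (Y x) : Π x : M, TangentSpace 𝓘(ℝ, E) x)) x :=
    FiberBundle.mdifferentiableAt_extend 𝓘(ℝ, E) E (Y x)
  have h := htens.pointwise hY hext (by simp)
  have e : (fun y ↦ (T (⟨y, (FiberBundle.extend E (Y x) : Π x : M, TangentSpace 𝓘(ℝ, E) x) y⟩ :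
      TangentBundle 𝓘(ℝ, E) M)).2) =ᶠ[𝓝 x] fun _ ↦ (T ⟨x, Y x⟩).2 := by
    filter_upwards [hbase] with y hy
    simp [FiberBundle.extend, ← hT, hy]
  simp only [e.mvfderiv_apply_eq, mvfderiv_const, _root_.zero_apply, map_zero, sub_zero] at h
  rw [← h]
  abel

variable {φ : OpenPartialHomeomorph M E} (hφ : φ ∈ IsManifold.maximalAtlas 𝓘(ℝ, E) ∞ M)
include hφ

/-- The covariant derivative of a vector field along a map, in the chart `φ`. -/
theorem chartVec_covDerivAlong {f : S → M} {p : S}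
    (hf : MDifferentiableAt 𝓘(ℝ, E') 𝓘(ℝ, E) f p) (hp : f p ∈ φ.source)
    {Z : Π q : S, TangentSpace 𝓘(ℝ, E) (f q)}
    (hZ : MDifferentiableAt 𝓘(ℝ, E') 𝓘(ℝ, E) (fun q ↦ chartVec φ ⟨f q, Z q⟩) p)
    (v : TangentSpace 𝓘(ℝ, E') p) :
    chartVec φ ⟨f p, covDerivAlong cov f Z p v⟩ =
      mvfderiv 𝓘(ℝ, E') (fun q ↦ chartVec φ ⟨f q, Z q⟩) p v +
      chartVec φ ⟨f p, cov (chartField φ (chartVec φ ⟨f p, Z p⟩)) (f p)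
        (mfderiv 𝓘(ℝ, E') 𝓘(ℝ, E) f p v)⟩ := by
  have : IsManifold 𝓘(ℝ, E) 2 M := IsManifold.of_le (n := ∞) (WithTop.coe_le_coe.2 le_top)
  set T := trivializationAt E (TangentSpace 𝓘(ℝ, E) : M → Type _) (f p) with hT
  have hx : f p ∈ T.baseSet := FiberBundle.mem_baseSet_trivializationAt' (f p)
  -- the change of frame
  let A (x : M) : E →L[ℝ] E :=
    (T.continuousLinearMapAt ℝ x : E →L[ℝ] E).comp (mfderiv 𝓘(ℝ, E) 𝓘(ℝ, E) φ x).inverse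
  have hA {x : M} (hx : x ∈ T.baseSet) (z : E) :
      A x z = (T (⟨x, chartField φ z x⟩ : TangentBundle 𝓘(ℝ, E) M)).2 := by
    change T.continuousLinearMapAt ℝ x (chartField φ z x) = _
    rw [T.continuousLinearMapAt_apply ℝ, T.coe_linearMapAt_of_mem hx]
  set U : Set E := φ.target ∩ φ.symm ⁻¹' T.baseSet with hU
  have hUo : IsOpen U := φ.isOpen_inter_preimage_symm T.open_baseSet
  have hB : ContDiffOn ℝ 1 (fun y ↦ A (φ.symm y)) U := by
    rw [contDiffOn_clm_apply]
    intro z y hy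
    have h1 : ContMDiffAt 𝓘(ℝ, E) 𝓘(ℝ, E) 1
        (fun x ↦ (T (⟨x, chartField φ z x⟩ : TangentBundle 𝓘(ℝ, E) M)).2) (φ.symm y) :=
      (T.contMDiffAt_section_iff (IB := 𝓘(ℝ, E)) hy.2).1
        ((contMDiffAt_chartField hφ (φ.map_target hy.1) z).of_le (by simp))
    have h2 := h1.comp y ((contMDiffAt_symm_of_mem_maximalAtlas hφ hy.1).of_le (by simp))
    refine (h2.contDiffAt.congr_of_eventuallyEq ?_).contDiffWithinAt
    filter_upwards [hUo.mem_nhds hy] with y' hy' using hA hy'.2 z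
  have hφd : MDifferentiableAt 𝓘(ℝ, E) 𝓘(ℝ, E) φ (f p) :=
    (mdifferentiable_of_mem_maximalAtlas hφ).mdifferentiableAt hp
  have hy : φ (f p) ∈ U := ⟨φ.map_source hp, by simpa [φ.left_inv hp] using hx⟩
  have hBd : DifferentiableAt ℝ (fun y ↦ A (φ.symm y)) (φ (f p)) :=
    (hB.contDiffAt (hUo.mem_nhds hy)).differentiableAt one_ne_zero
  have hW : ∀ᶠ x in 𝓝 (f p), x ∈ φ.source ∧ x ∈ T.baseSet :=
    Filter.Eventually.and (φ.open_source.mem_nhds hp) (T.open_baseSet.mem_nhds hx)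
  set ζ := chartVec φ ⟨f p, Z p⟩ with hζ
  have hZp : chartField φ ζ (f p) = Z p := chartField_chartVec hφ hp (Z p)
  have hsec := mdifferentiableAt_chartField hφ hp ζ
  set w := mfderiv 𝓘(ℝ, E') 𝓘(ℝ, E) f p v with hw
  -- The components of `Z` in the trivialization are `A` applied to its chart components. The
  -- product rule then splits off a derivative of the frame.
  have e1 : (fun q ↦ (T (⟨f q, Z q⟩ : TangentBundle 𝓘(ℝ, E) M)).2) =ᶠ[𝓝 p]
      fun q ↦ A (φ.symm (φ (f q))) (chartVec φ ⟨f q, Z q⟩) := by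
    filter_upwards [hf.continuousAt hW] with q hq
    rw [φ.left_inv hq.1, hA hq.2, chartField_chartVec hφ hq.1]
  have e2 : (fun x ↦ (T (⟨x, chartField φ ζ x⟩ : TangentBundle 𝓘(ℝ, E) M)).2) =ᶠ[𝓝 (f p)]
      fun x ↦ A (φ.symm (φ x)) ζ := by
    filter_upwards [hW] with x hx
    rw [φ.left_inv hx.1, hA hx.2]
  have hφf : MDifferentiableAt 𝓘(ℝ, E') 𝓘(ℝ, E) (fun q ↦ φ (f q)) p := hφd.comp p hf
  have hD (y' ζ' : E) : fderiv ℝ (fun a : E × E ↦ A (φ.symm a.1) a.2) (φ (f p), ζ) (y', ζ') =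
      A (f p) ζ' + fderiv ℝ (fun y ↦ A (φ.symm y)) (φ (f p)) y' ζ := by
    have h1 : HasFDerivAt (fun a : E × E ↦ A (φ.symm a.1)) _ (φ (f p), ζ) :=
      HasFDerivAt.comp (g := fun y ↦ A (φ.symm y)) (φ (f p), ζ) hBd.hasFDerivAt hasFDerivAt_fst
    rw [(HasFDerivAt.clm_apply h1 hasFDerivAt_snd).fderiv]
    simp [φ.left_inv hp]
  have hDd : DifferentiableAt ℝ (fun a : E × E ↦ A (φ.symm a.1) a.2) (φ (f p), ζ) :=
    (DifferentiableAt.comp (g := fun y ↦ A (φ.symm y)) (φ (f p), ζ) hBd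
      differentiableAt_fst).clm_apply differentiableAt_snd
  have hφd' (u : TangentSpace 𝓘(ℝ, E) (f p)) :
      mvfderiv 𝓘(ℝ, E) φ (f p) u = chartVec φ ⟨f p, u⟩ := rfl
  have hpair : mvfderiv 𝓘(ℝ, E') (fun q ↦ (φ (f q), chartVec φ ⟨f q, Z q⟩)) p v =
      (chartVec φ ⟨f p, w⟩, mvfderiv 𝓘(ℝ, E') (fun q ↦ chartVec φ ⟨f q, Z q⟩) p v) := by
    have hpd := hφf.prodMk_space hZ
    have h1 := mvfderiv_comp_fderiv (g := Prod.fst) differentiableAt_fst hpd v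
    have h2 := mvfderiv_comp_fderiv (g := Prod.snd) differentiableAt_snd hpd v
    rw [fderiv_fst] at h1
    rw [fderiv_snd] at h2
    refine Prod.ext (h1.symm.trans ?_) h2.symm
    exact congrArg (fun L : E' →L[ℝ] E ↦ L v) (mfderiv_comp p hφd hf)
  have hZd : mvfderiv 𝓘(ℝ, E') (fun q ↦ (T (⟨f q, Z q⟩ : TangentBundle 𝓘(ℝ, E) M)).2) p v =
      A (f p) (mvfderiv 𝓘(ℝ, E') (fun q ↦ chartVec φ ⟨f q, Z q⟩) p v) +
        fderiv ℝ (fun y ↦ A (φ.symm y)) (φ (f p)) (chartVec φ ⟨f p, w⟩) ζ := by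
    rw [e1.mvfderiv_apply_eq]
    refine (mvfderiv_comp_fderiv (h := fun q ↦ (φ (f q), chartVec φ ⟨f q, Z q⟩))
      (g := fun a : E × E ↦ A (φ.symm a.1) a.2) hDd (hφf.prodMk_space hZ) v).trans ?_
    rw [hpair]
    exact hD _ _
  have hFd : mvfderiv 𝓘(ℝ, E) (fun x ↦ (T (⟨x, chartField φ ζ x⟩ : TangentBundle 𝓘(ℝ, E) M)).2)
      (f p) w = fderiv ℝ (fun y ↦ A (φ.symm y)) (φ (f p)) (chartVec φ ⟨f p, w⟩) ζ := by
    rw [e2.mvfderiv_apply_eq, mvfderiv_comp_fderiv (g := fun y ↦ A (φ.symm y) ζ)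
      (hBd.clm_apply (differentiableAt_const ζ)) hφd, hφd',
      fderiv_clm_apply hBd (differentiableAt_const ζ)]
    simp
  have hsymm (z : E) : T.symmL ℝ (f p) (A (f p) z) = chartField φ z (f p) :=
    T.symmL_continuousLinearMapAt hx _
  -- The field with frozen chart components `ζ` has the same frame-derivative term, so that term is
  -- absorbed into its covariant derivative.
  have hcov := cov_trivializationAt cov hsec w
  rw [hFd, hZp] at hcov
  have hmain : covDerivAlong cov f Z p v =
      chartField φ (mvfderiv 𝓘(ℝ, E') (fun q ↦ chartVec φ ⟨f q, Z q⟩) p v) (f p) +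
        cov (chartField φ ζ) (f p) w := by
    rw [covDerivAlong, hZd, map_add, hsymm, add_assoc]
    exact congrArg _ hcov.symm
  rw [hmain]
  refine (map_add (mfderiv 𝓘(ℝ, E) 𝓘(ℝ, E) φ (f p)) _ _).trans ?_
  exact congrArg (· + _) (chartVec_chartField hφ hp _)

end ChartFormula

/-! ### Christoffel symbols -/

section Christoffel

variable {E : Type*} [NormedAddCommGroup E] [NormedSpace ℝ E] [FiniteDimensional ℝ E]
  {M : Type*} [TopologicalSpace M] [ChartedSpace E M] [IsManifold 𝓘(ℝ, E) ∞ M]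

/-- A smooth vector field on an open set agrees, near any of its points, with a smooth vector field
on the whole manifold. -/
lemma exists_contMDiff_section_eventuallyEq [T2Space M] {U : Set M}
    (hU : IsOpen U) {x : M} (hx : x ∈ U) {Y : Π x : M, TangentSpace 𝓘(ℝ, E) x}
    (hY : ContMDiffOn 𝓘(ℝ, E) 𝓘(ℝ, E).tangent ∞
      (fun x ↦ (⟨x, Y x⟩ : TangentBundle 𝓘(ℝ, E) M)) U) :
    ∃ X : Π x : M, TangentSpace 𝓘(ℝ, E) x, ContMDiff 𝓘(ℝ, E) 𝓘(ℝ, E).tangent ∞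
      (fun x ↦ (⟨x, X x⟩ : TangentBundle 𝓘(ℝ, E) M)) ∧ ∀ᶠ y in 𝓝 x, X y = Y y := by
  obtain ⟨ρ, -, hρ⟩ := (SmoothBumpFunction.nhds_basis_tsupport (I := 𝓘(ℝ, E)) x).mem_iff.1
    (hU.mem_nhds hx)
  refine ⟨(ρ : M → ℝ) • Y, ρ.contMDiff.contMDiffOn.smul_section_of_tsupport hU hρ hY, ?_⟩
  filter_upwards [ρ.eventuallyEq_one] with y hy
  simp [hy]

variable (cov : CovariantDerivative 𝓘(ℝ, E) E (TangentSpace 𝓘(ℝ, E) : M → Type _))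
  (φ : OpenPartialHomeomorph M E)

/-- The Christoffel symbols, in the chart `φ`, of a connection: `christoffel cov φ y z w` is
`∇_w z` at `y`, for constant coordinate fields `w` and `z`. -/
def christoffel (y : E) : E →L[ℝ] E →L[ℝ] E :=
  ∑ i, ((Module.finBasis ℝ E).coord i).toContinuousLinearMap.smulRight
    ((mfderiv 𝓘(ℝ, E) 𝓘(ℝ, E) φ (φ.symm y) : E →L[ℝ] E).comp
      ((cov (chartField φ (Module.finBasis ℝ E i)) (φ.symm y) : E →L[ℝ] E).comp
        (mfderiv 𝓘(ℝ, E) 𝓘(ℝ, E) φ (φ.symm y) : E →L[ℝ] E).inverse))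

variable {φ} (hφ : φ ∈ IsManifold.maximalAtlas 𝓘(ℝ, E) ∞ M)
include hφ

/-- The basis sum makes `christoffel` bilinear at every `y`. On the chart domain coordinate fields
are differentiable, so the connection is linear in them and the basis drops out. -/
lemma christoffel_apply {x : M} (hx : x ∈ φ.source) (z w : E) :
    christoffel cov φ (φ x) z w =
      chartVec φ ⟨x, cov (chartField φ z) x (chartField φ w x)⟩ := by
  have hadd (z z' : E) : chartVec φ ⟨x, cov (chartField φ (z + z')) x (chartField φ w x)⟩ =
      chartVec φ ⟨x, cov (chartField φ z) x (chartField φ w x)⟩ +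
      chartVec φ ⟨x, cov (chartField φ z') x (chartField φ w x)⟩ := by
    rw [chartField_add, cov.isCovariantDerivativeOnUniv.add (mdifferentiableAt_chartField hφ hx _)
      (mdifferentiableAt_chartField hφ hx _)]
    exact map_add (mfderiv 𝓘(ℝ, E) 𝓘(ℝ, E) φ x) _ _
  have hsmul (c : ℝ) (z : E) : chartVec φ ⟨x, cov (chartField φ (c • z)) x (chartField φ w x)⟩ =
      c • chartVec φ ⟨x, cov (chartField φ z) x (chartField φ w x)⟩ := by
    rw [chartField_smul, cov.isCovariantDerivativeOnUniv.smul_const c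
      (mdifferentiableAt_chartField hφ hx _)]
    exact map_smul (mfderiv 𝓘(ℝ, E) 𝓘(ℝ, E) φ x) c _
  let ℓ : E →ₗ[ℝ] E :=
    { toFun z := chartVec φ ⟨x, cov (chartField φ z) x (chartField φ w x)⟩
      map_add' := hadd
      map_smul' := hsmul }
  change _ = ℓ z
  conv_rhs => rw [← (Module.finBasis ℝ E).sum_repr z, map_sum]
  rw [christoffel, _root_.sum_apply, _root_.sum_apply, φ.left_inv hx]
  refine Finset.sum_congr rfl fun i _ ↦ ?_
  rw [map_smul]
  rfl

lemma contDiffOn_christoffel [T2Space M]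
    (hcov : CovariantDerivative.ContMDiffCovariantDerivative cov ∞) :
    ContDiffOn ℝ ∞ (christoffel cov φ) φ.target := by
  rw [contDiffOn_clm_apply]
  -- Smoothness of the connection is applied to a globally smooth field, so the coordinate field is
  -- cut off by a bump function; locality of the connection shows that nothing changes near the
  -- point.
  intro z
  rw [contDiffOn_clm_apply]
  intro w y hy
  have hx : φ.symm y ∈ φ.source := φ.map_target hy
  obtain ⟨Y, hY, hYz⟩ := exists_contMDiff_section_eventuallyEq φ.open_source hx
    fun x hx ↦ (contMDiffAt_chartField hφ hx z).contMDiffWithinAt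
  have h1 := ((hcov.contMDiff.contMDiff (σ := Y) (by simpa using! hY.contMDiffOn)).contMDiffAt
    Filter.univ_mem).clm_bundle_apply (contMDiffAt_chartField hφ hx w)
  have h2 := (contMDiffAt_chartVec hφ (v := ⟨φ.symm y, cov Y (φ.symm y) (chartField φ w (φ.symm y))⟩)
    hx).comp (φ.symm y) h1
  have h3 := h2.comp y (contMDiffAt_symm_of_mem_maximalAtlas hφ hy)
  refine (h3.contDiffAt.congr_of_eventuallyEq ?_).contDiffWithinAt
  have h4 : ∀ᶠ x in 𝓝 (φ.symm y), cov Y x = cov (chartField φ z) x := by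
    filter_upwards [hYz.eventually_nhds, φ.open_source.mem_nhds hx] with x hx hxs
    exact cov.isCovariantDerivativeOnUniv.congr_of_eventuallyEq
      ((hY.contMDiffAt).mdifferentiableAt (by simp)) (mdifferentiableAt_chartField hφ hxs z)
      Filter.univ_mem hx
  filter_upwards [(φ.continuousAt_symm hy).eventually h4, φ.open_target.mem_nhds hy] with y' h5 hy'
  have := christoffel_apply cov hφ (φ.map_target hy') z w
  rw [φ.right_inv hy'] at this
  rw [this, ← h5]
  rfl

/-- Torsion-freeness applied to commuting coordinate fields. -/
lemma christoffel_symm {g : SemiRiemannianMetric E M} (hcov : IsLeviCivita g cov) {y : E}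
    (hy : y ∈ φ.target) (z w : E) : christoffel cov φ y z w = christoffel cov φ y w z := by
  have hx := φ.map_target hy
  have h1 := hcov.torsion_free (chartField φ w) (chartField φ z) (φ.symm y)
    (mdifferentiableAt_chartField hφ hx w) (mdifferentiableAt_chartField hφ hx z)
  rw [mlieBracket_chartField hφ hx, sub_eq_zero] at h1
  rw [← φ.right_inv hy, christoffel_apply cov hφ hx, christoffel_apply cov hφ hx, h1]

end Christoffel

/-! ### The metric in coordinates -/

section ChartMetric

variable {E : Type*} [NormedAddCommGroup E] [NormedSpace ℝ E] [FiniteDimensional ℝ E]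
  {M : Type*} [TopologicalSpace M] [ChartedSpace E M] [IsManifold 𝓘(ℝ, E) ∞ M]

/-- The coordinate expression of a metric in the chart `φ`. -/
def chartMetric (g : SemiRiemannianMetric E M) (φ : OpenPartialHomeomorph M E) (y : E) :
    E →L[ℝ] E →L[ℝ] ℝ :=
  ContinuousLinearMap.bilinearComp (E := E) (F := E) (g.form (φ.symm y))
    (mfderiv 𝓘(ℝ, E) 𝓘(ℝ, E) φ (φ.symm y) : E →L[ℝ] E).inverse
    (mfderiv 𝓘(ℝ, E) 𝓘(ℝ, E) φ (φ.symm y) : E →L[ℝ] E).inverse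

variable {g : SemiRiemannianMetric E M} {φ : OpenPartialHomeomorph M E}

omit [FiniteDimensional ℝ E] in
lemma chartMetric_apply {x : M} (hx : x ∈ φ.source) (v w : E) :
    chartMetric g φ (φ x) v w = g.form x (chartField φ v x) (chartField φ w x) := by
  change g.form (φ.symm (φ x)) (chartField φ v (φ.symm (φ x)))
    (chartField φ w (φ.symm (φ x))) = _
  rw [φ.left_inv hx]

variable (hφ : φ ∈ IsManifold.maximalAtlas 𝓘(ℝ, E) ∞ M)
include hφ

omit [FiniteDimensional ℝ E] in
lemma chartMetric_chartVec {x : M} (hx : x ∈ φ.source) (v w : TangentSpace 𝓘(ℝ, E) x) :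
    chartMetric g φ (φ x) (chartVec φ ⟨x, v⟩) (chartVec φ ⟨x, w⟩) = g.form x v w := by
  rw [chartMetric_apply hx, chartField_chartVec hφ hx, chartField_chartVec hφ hx]

lemma contMDiffAt_form_chartField {x : M} (hx : x ∈ φ.source) (v w : E) :
    ContMDiffAt 𝓘(ℝ, E) 𝓘(ℝ, ℝ) ∞
      (fun x ↦ g.form x (chartField φ v x) (chartField φ w x)) x := by
  have h := ContMDiffAt.clm_bundle_apply₂ (F₃ := ℝ) (E₃ := Bundle.Trivial M ℝ) (b := fun x : M ↦ x)
    (g.contMDiff.contMDiffAt (x := x)) (contMDiffAt_chartField hφ hx v)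
    (contMDiffAt_chartField hφ hx w)
  exact (contMDiffAt_totalSpace.1 h).2

lemma contDiffOn_chartMetric : ContDiffOn ℝ ∞ (chartMetric g φ) φ.target := by
  rw [contDiffOn_clm_apply]
  intro v
  rw [contDiffOn_clm_apply]
  intro w y hy
  have hx : φ.symm y ∈ φ.source := φ.map_target hy
  have h := (contMDiffAt_form_chartField (g := g) hφ hx v w).comp y
    (contMDiffAt_symm_of_mem_maximalAtlas hφ hy)
  exact h.contDiffAt.contDiffWithinAt

/-- Metric compatibility on coordinate fields differentiates in the second slot of `christoffel`;
symmetry moves the direction `u` to the first. This is the parallelism that the null argument needs.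
-/
lemma fderiv_chartMetric {cov : CovariantDerivative 𝓘(ℝ, E) E (TangentSpace 𝓘(ℝ, E) : M → Type _)}
    (hcov : IsLeviCivita g cov) {y : E} (hy : y ∈ φ.target) (u v w : E) :
    fderiv ℝ (chartMetric g φ) y u v w =
      chartMetric g φ y (christoffel cov φ y u v) w +
        chartMetric g φ y v (christoffel cov φ y u w) := by
  rw [christoffel_symm cov hφ hcov hy u v, christoffel_symm cov hφ hcov hy u w]
  obtain ⟨x, hx, rfl⟩ : ∃ x ∈ φ.source, φ x = y := ⟨φ.symm y, φ.map_target hy, φ.right_inv hy⟩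
  have hGd : DifferentiableAt ℝ (chartMetric g φ) (φ x) :=
    ((contDiffOn_chartMetric hφ).contDiffAt (φ.open_target.mem_nhds hy)).differentiableAt (by simp)
  have h1 := hcov.metric (chartField φ v) (chartField φ w) x (chartField φ u x)
    (mdifferentiableAt_chartField hφ hx v) (mdifferentiableAt_chartField hφ hx w)
  have e : (fun x ↦ g.form x (chartField φ v x) (chartField φ w x)) =ᶠ[𝓝 x]
      fun x ↦ chartMetric g φ (φ x) v w := by
    filter_upwards [φ.open_source.mem_nhds hx] with x' hx' using (chartMetric_apply hx' v w).symm
  have hGv := hGd.clm_apply (differentiableAt_const v)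
  rw [e.mvfderiv_apply_eq, mvfderiv_comp_fderiv (g := fun y ↦ chartMetric g φ y v w)
    (hGv.clm_apply (differentiableAt_const w))
    ((mdifferentiable_of_mem_maximalAtlas hφ).mdifferentiableAt hx)] at h1
  have h2 : mvfderiv 𝓘(ℝ, E) φ x (chartField φ u x) = u := chartVec_chartField hφ hx u
  rw [h2, fderiv_clm_apply hGv (differentiableAt_const w),
    fderiv_clm_apply hGd (differentiableAt_const v)] at h1
  rw [← chartMetric_chartVec hφ hx, ← chartMetric_chartVec hφ hx, chartVec_chartField hφ hx,
    chartVec_chartField hφ hx, ← christoffel_apply cov hφ hx, ← christoffel_apply cov hφ hx] at h1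
  simpa using h1

end ChartMetric

/-! ### Geodesics in a chart -/

section AlongMaps

variable {E : Type*} [NormedAddCommGroup E] [NormedSpace ℝ E] [FiniteDimensional ℝ E]
  {M : Type*} [TopologicalSpace M] [ChartedSpace E M] [IsManifold 𝓘(ℝ, E) ∞ M]
  {E' : Type*} [NormedAddCommGroup E'] [NormedSpace ℝ E']
  {S : Type*} [TopologicalSpace S] [ChartedSpace E' S]
  (cov : CovariantDerivative 𝓘(ℝ, E) E (TangentSpace 𝓘(ℝ, E) : M → Type _))
  {φ : OpenPartialHomeomorph M E} (hφ : φ ∈ IsManifold.maximalAtlas 𝓘(ℝ, E) ∞ M)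
include hφ

/-- The covariant derivative of a vector field along a map, in terms of Christoffel symbols. -/
theorem chartVec_covDerivAlong_christoffel {f : S → M} {p : S}
    (hf : MDifferentiableAt 𝓘(ℝ, E') 𝓘(ℝ, E) f p) (hp : f p ∈ φ.source)
    {Z : Π q : S, TangentSpace 𝓘(ℝ, E) (f q)}
    (hZ : MDifferentiableAt 𝓘(ℝ, E') 𝓘(ℝ, E) (fun q ↦ chartVec φ ⟨f q, Z q⟩) p)
    (v : TangentSpace 𝓘(ℝ, E') p) :
    chartVec φ ⟨f p, covDerivAlong cov f Z p v⟩ =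
      mvfderiv 𝓘(ℝ, E') (fun q ↦ chartVec φ ⟨f q, Z q⟩) p v +
      christoffel cov φ (φ (f p)) (chartVec φ ⟨f p, Z p⟩)
        (chartVec φ ⟨f p, mfderiv 𝓘(ℝ, E') 𝓘(ℝ, E) f p v⟩) := by
  rw [chartVec_covDerivAlong cov hφ hf hp hZ, christoffel_apply cov hφ hp,
    chartField_chartVec hφ hp (mfderiv 𝓘(ℝ, E') 𝓘(ℝ, E) f p v)]

omit [FiniteDimensional ℝ E] [IsManifold 𝓘(ℝ, E) ∞ M] in
lemma hasDerivAt_chart_comp {γ : ℝ → M} {t : ℝ} (hγ : MDifferentiableAt 𝓘(ℝ, ℝ) 𝓘(ℝ, E) γ t)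
    (ht : γ t ∈ φ.source) :
    HasDerivAt (fun t ↦ φ (γ t)) (chartVec φ ⟨γ t, velocity γ t⟩) t := by
  have h1 : HasFDerivAt (fun t ↦ φ (γ t))
      ((mfderiv 𝓘(ℝ, E) 𝓘(ℝ, E) φ (γ t) : E →L[ℝ] E).comp
        (mfderiv 𝓘(ℝ, ℝ) 𝓘(ℝ, E) γ t : ℝ →L[ℝ] E)) t :=
    (((mdifferentiable_of_mem_maximalAtlas hφ).mdifferentiableAt ht).hasMFDerivAt.comp t
      hγ.hasMFDerivAt).hasFDerivAt
  have key (A : E →L[ℝ] E) (B : ℝ →L[ℝ] E) (h : HasFDerivAt (fun t ↦ φ (γ t)) (A.comp B) t) :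
      HasDerivAt (fun t ↦ φ (γ t)) (A (B 1)) t := h.hasDerivAt
  exact key _ _ h1

/-- A geodesic satisfies the geodesic equation in any chart. -/
lemma IsGeodesicOn.hasDerivAt_chartVec {γ : ℝ → M} {J : Set ℝ} (hγ : IsGeodesicOn cov γ J)
    (hJ : IsOpen J) {t : ℝ} (ht : t ∈ J) (htφ : γ t ∈ φ.source) :
    HasDerivAt (fun t ↦ φ (γ t)) (chartVec φ ⟨γ t, velocity γ t⟩) t ∧
    HasDerivAt (fun t ↦ chartVec φ ⟨γ t, velocity γ t⟩)
      (-christoffel cov φ (φ (γ t)) (chartVec φ ⟨γ t, velocity γ t⟩)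
        (chartVec φ ⟨γ t, velocity γ t⟩)) t := by
  have hsm {s : ℝ} (hs : s ∈ J) : ContMDiffAt 𝓘(ℝ, ℝ) 𝓘(ℝ, E) ∞ γ s :=
    hγ.smooth.contMDiffAt (hJ.mem_nhds hs)
  have hd {s : ℝ} (hs : s ∈ J) : MDifferentiableAt 𝓘(ℝ, ℝ) 𝓘(ℝ, E) γ s :=
    (hsm hs).mdifferentiableAt (by simp)
  have hx : ContDiffAt ℝ ∞ (fun t ↦ φ (γ t)) t :=
    ((contMDiffAt_of_mem_maximalAtlas hφ htφ).comp t (hsm ht)).contDiffAt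
  -- Near `t` the velocity coordinates are the derivative of the smooth curve `φ ∘ γ`, hence
  -- differentiable, as the formula for `covDerivAlong` requires.
  have hev : (fun t ↦ chartVec φ ⟨γ t, velocity γ t⟩) =ᶠ[𝓝 t] deriv fun t ↦ φ (γ t) := by
    filter_upwards [hJ.mem_nhds ht,
      (hd ht).continuousAt.eventually (φ.open_source.mem_nhds htφ)] with s hs hsφ
    exact (hasDerivAt_chart_comp hφ (hd hs) hsφ).deriv.symm
  have hy : DifferentiableAt ℝ (fun t ↦ chartVec φ ⟨γ t, velocity γ t⟩) t := by
    refine DifferentiableAt.congr_of_eventuallyEq ?_ hev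
    have h1 : ContDiffAt ℝ 1 (fderiv ℝ fun t ↦ φ (γ t)) t :=
      ContDiffAt.fderiv_right hx (WithTop.coe_le_coe.2 le_top)
    exact (h1.differentiableAt one_ne_zero).clm_apply (differentiableAt_const (1 : ℝ))
  refine ⟨hasDerivAt_chart_comp hφ (hd ht) htφ, ?_⟩
  have h := chartVec_covDerivAlong_christoffel cov hφ (hd ht) htφ (Z := velocity γ)
    hy.mdifferentiableAt (1 : ℝ)
  rw [hγ.geodesic t ht] at h
  have h0 : chartVec φ ⟨γ t, 0⟩ = 0 := map_zero (mfderiv 𝓘(ℝ, E) 𝓘(ℝ, E) φ (γ t))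
  rw [h0] at h
  have h1 : mvfderiv 𝓘(ℝ, ℝ) (fun t ↦ chartVec φ ⟨γ t, velocity γ t⟩) t (1 : ℝ) =
      deriv (fun t ↦ chartVec φ ⟨γ t, velocity γ t⟩) t :=
    congrArg (fun L : ℝ →L[ℝ] E ↦ L 1) mfderiv_eq_fderiv
  rw [h1] at h
  exact hy.hasDerivAt.congr_deriv (eq_neg_of_add_eq_zero_left h.symm)

/-- A solution of the geodesic equation in a chart is a geodesic. -/
lemma isGeodesicOn_of_hasDerivAt {x y : ℝ → E} {J : Set ℝ} (hJ : IsOpen J)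
    (hx : ContDiffOn ℝ ∞ x J) (h : ∀ t ∈ J, x t ∈ φ.target ∧ HasDerivAt x (y t) t ∧
      HasDerivAt y (-christoffel cov φ (x t) (y t) (y t)) t) :
    IsGeodesicOn cov (fun t ↦ φ.symm (x t)) J ∧
      ∀ t ∈ J, chartVec φ ⟨φ.symm (x t), velocity (fun t ↦ φ.symm (x t)) t⟩ = y t := by
  have hsm {t : ℝ} (ht : t ∈ J) : ContMDiffAt 𝓘(ℝ, ℝ) 𝓘(ℝ, E) ∞ (fun t ↦ φ.symm (x t)) t :=
    (contMDiffAt_symm_of_mem_maximalAtlas hφ (h t ht).1).comp t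
      (hx.contDiffAt (hJ.mem_nhds ht)).contMDiffAt
  have hd {t : ℝ} (ht : t ∈ J) : MDifferentiableAt 𝓘(ℝ, ℝ) 𝓘(ℝ, E) (fun t ↦ φ.symm (x t)) t :=
    (hsm ht).mdifferentiableAt (by simp)
  have hs {t : ℝ} (ht : t ∈ J) : φ.symm (x t) ∈ φ.source := φ.map_target (h t ht).1
  have hvel {t : ℝ} (ht : t ∈ J) :
      chartVec φ ⟨φ.symm (x t), velocity (fun t ↦ φ.symm (x t)) t⟩ = y t := by
    refine (hasDerivAt_chart_comp hφ (hd ht) (hs ht)).unique ((h t ht).2.1.congr_of_eventuallyEq ?_)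
    filter_upwards [hJ.mem_nhds ht] with s hs using φ.right_inv (h s hs).1
  refine ⟨⟨fun t ht ↦ (hsm ht).contMDiffWithinAt, fun t ht ↦ ?_⟩, fun t ht ↦ hvel ht⟩
  have hev : (fun t ↦ chartVec φ ⟨φ.symm (x t), velocity (fun t ↦ φ.symm (x t)) t⟩) =ᶠ[𝓝 t] y := by
    filter_upwards [hJ.mem_nhds ht] with s hs using hvel hs
  have hyd : HasDerivAt _ _ t := (h t ht).2.2.congr_of_eventuallyEq hev
  have h1 := chartVec_covDerivAlong_christoffel cov hφ (hd ht) (hs ht)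
    (Z := velocity (fun t ↦ φ.symm (x t))) hyd.differentiableAt.mdifferentiableAt (1 : ℝ)
  have h2 : mvfderiv 𝓘(ℝ, ℝ) (fun t ↦ chartVec φ
      ⟨φ.symm (x t), velocity (fun t ↦ φ.symm (x t)) t⟩) t (1 : ℝ) = deriv _ t :=
    congrArg (fun L : ℝ →L[ℝ] E ↦ L 1) mfderiv_eq_fderiv
  have h3 : chartVec φ ⟨φ.symm (x t), mfderiv 𝓘(ℝ, ℝ) 𝓘(ℝ, E) (fun t ↦ φ.symm (x t)) t (1 : ℝ)⟩ =
    y t := hvel ht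
  rw [h2, h3, hvel ht, hyd.deriv, φ.right_inv (h t ht).1, neg_add_cancel] at h1
  exact ((mdifferentiable_of_mem_maximalAtlas hφ).mfderiv_injective (hs ht))
    (h1.trans (map_zero (mfderiv 𝓘(ℝ, E) 𝓘(ℝ, E) φ (φ.symm (x t)))).symm)

end AlongMaps

/-! ### Charts adapted to an immersion -/

section AdaptedCharts

variable {E : Type*} [NormedAddCommGroup E] [NormedSpace ℝ E]
  {M : Type*} [TopologicalSpace M] [ChartedSpace E M]
  {E' : Type*} [NormedAddCommGroup E'] [NormedSpace ℝ E']
  {S : Type*} [TopologicalSpace S] [ChartedSpace E' S]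

/-- The charts `ψ` and `φ` are adapted to `f`: in these charts, `f` is the linear embedding `ι`,
with left inverse `P`. -/
structure AdaptedCharts (f : S → M) (ψ : OpenPartialHomeomorph S E')
    (φ : OpenPartialHomeomorph M E) (ι : E' →L[ℝ] E) (P : E →L[ℝ] E') : Prop where
  dom_mem : ψ ∈ IsManifold.maximalAtlas 𝓘(ℝ, E') ∞ S
  cod_mem : φ ∈ IsManifold.maximalAtlas 𝓘(ℝ, E) ∞ M
  left_inv (u : E') : P (ι u) = u
  mapsTo : MapsTo f ψ.source φ.source
  eq_on {q : S} (hq : q ∈ ψ.source) : φ (f q) = ι (ψ q)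

/-- In the normal form of an immersion, `f` reads `u ↦ (u, 0)` in `E' × F`; `ι` is this inclusion
and `P` the projection along `F`, both transported to `E`. -/
lemma exists_adaptedCharts {f : S → M} (hf : IsImmersion 𝓘(ℝ, E') 𝓘(ℝ, E) ∞ f) (p : S) :
    ∃ (ψ : OpenPartialHomeomorph S E') (φ : OpenPartialHomeomorph M E) (ι : E' →L[ℝ] E)
      (P : E →L[ℝ] E'), AdaptedCharts f ψ φ ι P ∧ p ∈ ψ.source := by
  obtain ⟨F, _, _, h⟩ := hf.isImmersionAt p
  refine ⟨h.domChart, h.codChart, (h.equiv : (E' × F) →L[ℝ] E).comp (.inl ℝ E' F),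
    (ContinuousLinearMap.fst ℝ E' F).comp (h.equiv.symm : E →L[ℝ] E' × F),
    ⟨h.domChart_mem_maximalAtlas, h.codChart_mem_maximalAtlas, fun u ↦ by simp,
      h.mapsto_domChart_source_codChart_source, fun {q} hq ↦ ?_⟩, h.mem_domChart_source⟩
  have := h.writtenInCharts (show h.domChart q ∈ (h.domChart.extend 𝓘(ℝ, E')).target by
    simpa using h.domChart.map_source hq)
  simpa [h.domChart.left_inv hq] using this

namespace AdaptedCharts

variable {f : S → M} {ψ : OpenPartialHomeomorph S E'} {φ : OpenPartialHomeomorph M E}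
  {ι : E' →L[ℝ] E} {P : E →L[ℝ] E'} (h : AdaptedCharts f ψ φ ι P)
  (hf : ContMDiff 𝓘(ℝ, E') 𝓘(ℝ, E) ∞ f)
include h

lemma map_symm {u : E'} (hu : u ∈ ψ.target) : φ (f (ψ.symm u)) = ι u := by
  rw [h.eq_on (ψ.map_target hu), ψ.right_inv hu]

lemma map_mem_target {q : S} (hq : q ∈ ψ.source) : ι (ψ q) ∈ φ.target := by
  rw [← h.eq_on hq]
  exact φ.map_source (h.mapsTo hq)

lemma mem_range_iff (x : E) : x ∈ range ι ↔ x - ι (P x) = 0 := by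
  refine ⟨?_, fun hx ↦ ⟨P x, (sub_eq_zero.1 hx).symm⟩⟩
  rintro ⟨u, rfl⟩
  rw [h.left_inv, sub_self]

include hf

lemma chartVec_mfderiv {q : S} (hq : q ∈ ψ.source) (v : TangentSpace 𝓘(ℝ, E') q) :
    chartVec φ ⟨f q, mfderiv 𝓘(ℝ, E') 𝓘(ℝ, E) f q v⟩ = ι (chartVec ψ ⟨q, v⟩) := by
  have hfd : MDifferentiableAt 𝓘(ℝ, E') 𝓘(ℝ, E) f q := hf.contMDiffAt.mdifferentiableAt (by simp)
  have hφd := (mdifferentiable_of_mem_maximalAtlas h.cod_mem).mdifferentiableAt (h.mapsTo hq)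
  have hψd := (mdifferentiable_of_mem_maximalAtlas h.dom_mem).mdifferentiableAt hq
  have e : (fun q ↦ φ (f q)) =ᶠ[𝓝 q] fun q ↦ ι (ψ q) := by
    filter_upwards [ψ.open_source.mem_nhds hq] with q' hq' using h.eq_on hq'
  have h1 := e.mvfderiv_apply_eq v
  rw [mvfderiv_comp_fderiv ι.differentiableAt hψd, ContinuousLinearMap.fderiv] at h1
  exact (congrArg (fun L : E' →L[ℝ] E ↦ L v) (mfderiv_comp q hφd hfd)).symm.trans h1

lemma mem_tangentImage {q : S} (hq : q ∈ ψ.source) (u : TangentSpace 𝓘(ℝ, E) (f q)) :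
    u ∈ tangentImage (E' := E') f q ↔ chartVec φ ⟨f q, u⟩ ∈ range ι := by
  constructor
  · rintro ⟨v, rfl⟩
    exact ⟨_, (h.chartVec_mfderiv hf hq v).symm⟩
  · rintro ⟨z, hz⟩
    refine ⟨chartField ψ z q, ?_⟩
    refine (mdifferentiable_of_mem_maximalAtlas h.cod_mem).mfderiv_injective (h.mapsTo hq) ?_
    refine (h.chartVec_mfderiv hf hq _).trans ?_
    rw [chartVec_chartField h.dom_mem hq]
    exact hz

variable [IsManifold 𝓘(ℝ, E') ∞ S] [IsManifold 𝓘(ℝ, E) ∞ M] [FiniteDimensional ℝ E]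
  (cov : CovariantDerivative 𝓘(ℝ, E) E (TangentSpace 𝓘(ℝ, E) : M → Type _))

/-- The coordinates of the pushed-forward field are `ι` of those of `Y`. Their derivative is again
in `range ι`, which leaves the Christoffel term modulo tangent vectors. -/
lemma chartVec_covDerivAlong_sub_mem {Y : Π q : S, TangentSpace 𝓘(ℝ, E') q}
    (hY : ContMDiff 𝓘(ℝ, E') 𝓘(ℝ, E').tangent ∞
      (fun q ↦ (⟨q, Y q⟩ : TangentBundle 𝓘(ℝ, E') S))) {q : S} (hq : q ∈ ψ.source)
    (v : TangentSpace 𝓘(ℝ, E') q) :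
    chartVec φ ⟨f q, covDerivAlong cov f (pushAlong f Y) q v⟩ -
      christoffel cov φ (ι (ψ q)) (ι (chartVec ψ ⟨q, Y q⟩)) (ι (chartVec ψ ⟨q, v⟩)) ∈ range ι := by
  have hfd : MDifferentiableAt 𝓘(ℝ, E') 𝓘(ℝ, E) f q := hf.contMDiffAt.mdifferentiableAt (by simp)
  have e : (fun q ↦ chartVec φ ⟨f q, pushAlong f Y q⟩) =ᶠ[𝓝 q] fun q ↦ ι (chartVec ψ ⟨q, Y q⟩) := by
    filter_upwards [ψ.open_source.mem_nhds hq] with q' hq' using h.chartVec_mfderiv hf hq' _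
  have he : chartVec φ ⟨f q, pushAlong f Y q⟩ = ι (chartVec ψ ⟨q, Y q⟩) :=
    h.chartVec_mfderiv hf hq _
  have hYψ : MDifferentiableAt 𝓘(ℝ, E') 𝓘(ℝ, E') (fun q ↦ chartVec ψ ⟨q, Y q⟩) q :=
    ((contMDiffAt_chartVec h.dom_mem (v := ⟨q, Y q⟩) hq).comp q hY.contMDiffAt).mdifferentiableAt
      (by simp)
  have hιY : MDifferentiableAt 𝓘(ℝ, E') 𝓘(ℝ, E) (fun q ↦ ι (chartVec ψ ⟨q, Y q⟩)) q :=
    ι.differentiableAt.mdifferentiableAt.comp q hYψ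
  rw [chartVec_covDerivAlong_christoffel cov h.cod_mem hfd (h.mapsTo hq)
    (hιY.congr_of_eventuallyEq e), e.mvfderiv_apply_eq, mvfderiv_comp_fderiv ι.differentiableAt hYψ,
    h.eq_on hq, h.chartVec_mfderiv hf hq, he, add_sub_cancel_right,
    ContinuousLinearMap.fderiv]
  exact mem_range_self _

end AdaptedCharts

end AdaptedCharts

/-! ### Umbilicity and geodesics in adapted charts -/

section Submanifolds

variable {E : Type*} [NormedAddCommGroup E] [NormedSpace ℝ E] [FiniteDimensional ℝ E]
  {M : Type*} [TopologicalSpace M] [ChartedSpace E M] [IsManifold 𝓘(ℝ, E) ∞ M]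
  {E' : Type*} [NormedAddCommGroup E'] [NormedSpace ℝ E']
  {S : Type*} [TopologicalSpace S] [ChartedSpace E' S] [IsManifold 𝓘(ℝ, E') ∞ S]
  (cov : CovariantDerivative 𝓘(ℝ, E) E (TangentSpace 𝓘(ℝ, E) : M → Type _))
  {f : S → M} {ψ : OpenPartialHomeomorph S E'} {φ : OpenPartialHomeomorph M E}
  {ι : E' →L[ℝ] E} {P : E →L[ℝ] E'}

namespace AdaptedCharts

variable (h : AdaptedCharts f ψ φ ι P) (hf : ContMDiff 𝓘(ℝ, E') 𝓘(ℝ, E) ∞ f)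
include h hf

/-- The second fundamental form in adapted charts. -/
lemma secondFundamentalForm_eq_mk_iff {X Y : Π q : S, TangentSpace 𝓘(ℝ, E') q}
    (hY : ContMDiff 𝓘(ℝ, E') 𝓘(ℝ, E').tangent ∞
      (fun q ↦ (⟨q, Y q⟩ : TangentBundle 𝓘(ℝ, E') S))) {q : S} (hq : q ∈ ψ.source)
    (n : TangentSpace 𝓘(ℝ, E) (f q)) :
    secondFundamentalForm cov f X Y q = Submodule.Quotient.mk n ↔
      christoffel cov φ (ι (ψ q)) (ι (chartVec ψ ⟨q, Y q⟩)) (ι (chartVec ψ ⟨q, X q⟩)) -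
        chartVec φ ⟨f q, n⟩ ∈ range ι := by
  have h1 := h.chartVec_covDerivAlong_sub_mem hf cov hY hq (X q)
  have h2 : chartVec φ ⟨f q, covDerivAlong cov f (pushAlong f Y) q (X q) - n⟩ =
      chartVec φ ⟨f q, covDerivAlong cov f (pushAlong f Y) q (X q)⟩ - chartVec φ ⟨f q, n⟩ :=
    map_sub (mfderiv 𝓘(ℝ, E) 𝓘(ℝ, E) φ (f q)) _ _
  rw [secondFundamentalForm, Submodule.Quotient.eq, h.mem_tangentImage hf hq, h2]
  obtain ⟨z, hz⟩ := h1
  rw [eq_sub_iff_add_eq] at hz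
  rw [← hz, add_sub_assoc]
  exact (LinearMap.range ι.toLinearMap).add_mem_iff_right (LinearMap.mem_range_self _ z)

/-- Umbilicity in adapted charts. -/
lemma christoffel_sub_mem [FiniteDimensional ℝ E'] [T2Space S] {g : SemiRiemannianMetric E M}
    {N : Π q : S, TangentSpace 𝓘(ℝ, E) (f q)} (hN : IsUmbilicWith E' g cov f N)
    {u : E'} (hu : u ∈ ψ.target) (v : E') :
    christoffel cov φ (ι u) (ι v) (ι v) - chartMetric g φ (ι u) (ι v) (ι v) •
      chartVec φ ⟨f (ψ.symm u), N (ψ.symm u)⟩ ∈ range ι := by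
  obtain ⟨q, hq, rfl⟩ : ∃ q ∈ ψ.source, ψ q = u := ⟨_, ψ.map_target hu, ψ.right_inv hu⟩
  rw [ψ.left_inv hq]
  -- Umbilicity is tested on global fields, so `v` is first realized as the value of one.
  obtain ⟨X, hX, hXq⟩ := exists_contMDiff_section_eventuallyEq ψ.open_source hq
    (fun q hq ↦ (contMDiffAt_chartField h.dom_mem hq v).contMDiffWithinAt)
  have hv : chartVec ψ ⟨q, X q⟩ = v := by
    rw [hXq.self_of_nhds, chartVec_chartField h.dom_mem hq]
  have h1 := (h.secondFundamentalForm_eq_mk_iff cov hf hX hq _).1 (hN.umbilic X X hX hX q)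
  have h2 : chartVec φ ⟨f q, pushAlong f X q⟩ = ι v :=
    (h.chartVec_mfderiv hf hq _).trans (congrArg ι hv)
  have h3 (c : ℝ) : chartVec φ ⟨f q, c • N q⟩ = c • chartVec φ ⟨f q, N q⟩ :=
    map_smul (mfderiv 𝓘(ℝ, E) 𝓘(ℝ, E) φ (f q)) _ _
  rw [h3, ← chartMetric_chartVec h.cod_mem (h.mapsTo hq), h2, h.eq_on hq, hv] at h1
  exact h1

omit [IsManifold 𝓘(ℝ, E') ∞ S] in
/-- A geodesic that starts tangentially to a submanifold which is umbilic in adapted charts, for a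
form `G` that is parallel and vanishes on the initial velocity, remains within the submanifold. -/
lemma remainsWithinNear [CompleteSpace E'] [T2Space M]
    (hcov : CovariantDerivative.ContMDiffCovariantDerivative cov ∞)
    {G : E → E →L[ℝ] E →L[ℝ] ℝ} {n : E' → E} {γ : ℝ → M} {J : Set ℝ} {t₀ : ℝ} {p : S}
    (hp : p ∈ ψ.source) (hn : ContinuousAt n (ψ p)) (hG : ContDiffOn ℝ ∞ G φ.target)
    (hpar : ∀ z ∈ φ.target, ∀ u v w, fderiv ℝ G z u v w =
      G z (christoffel cov φ z u v) w + G z v (christoffel cov φ z u w))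
    (humb : ∀ u ∈ ψ.target, ∀ v, christoffel cov φ (ι u) (ι v) (ι v) -
      G (ι u) (ι v) (ι v) • n u ∈ range ι)
    (hnull : G (φ (γ t₀)) (chartVec φ ⟨γ t₀, velocity γ t₀⟩)
      (chartVec φ ⟨γ t₀, velocity γ t₀⟩) = 0)
    (hJ : IsOpen J) (ht₀ : t₀ ∈ J) (hγ : IsGeodesicOn cov γ J)
    (hs : StartsTangentAt E E' f p γ t₀) : RemainsWithinNear f p γ t₀ := by
  obtain ⟨v, hv⟩ := hs
  have hγ₀ : γ t₀ = f p := congrArg TotalSpace.proj hv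
  have hxp : φ (γ t₀) = ι (ψ p) := by rw [hγ₀, h.eq_on hp]
  have hyp : chartVec φ ⟨γ t₀, velocity γ t₀⟩ = ι (chartVec ψ ⟨p, v⟩) :=
    (congrArg (chartVec φ) hv).trans (h.chartVec_mfderiv hf hp v)
  rw [hyp, hxp] at hnull
  have hγφ : ∀ᶠ t in 𝓝 t₀, γ t ∈ φ.source :=
    (hγ.smooth.contMDiffAt (hJ.mem_nhds ht₀)).continuousAt.eventually
      (φ.open_source.mem_nhds (hγ₀ ▸ h.mapsTo hp))
  have hxy := (hγφ.and (hJ.mem_nhds ht₀)).mono fun t ht ↦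
    hγ.hasDerivAt_chartVec cov h.cod_mem hJ ht.2 ht.1
  have hz := φ.open_target.mem_nhds (h.map_mem_target hp)
  have hGz {z : E} (hz : z ∈ φ.target) := hG.contDiffAt (φ.open_target.mem_nhds hz)
  obtain ⟨u, huc, hu₀, hu⟩ := exists_eventually_eq_of_geodesic h.left_inv
    (((contDiffOn_christoffel cov h.cod_mem hcov).contDiffAt hz).of_le (by simp)) hn
    (by filter_upwards [hz] with z hz using ⟨(hGz hz).differentiableAt (by simp), hpar z hz⟩)
    (hG.continuousOn.continuousAt hz)
    (by filter_upwards [ψ.open_target.mem_nhds (ψ.map_source hp)] with u hu using humb u hu)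
    hnull (hxy.mono fun t ht ↦ ht.1) (hxy.mono fun t ht ↦ ht.2) hxp hyp
  have huψ : ∀ᶠ t in 𝓝 t₀, u t ∈ ψ.target := huc.self_of_nhds.eventually
    (ψ.open_target.mem_nhds (by rw [hu₀]; exact ψ.map_source hp))
  obtain ⟨ε, hε, hball⟩ := Metric.eventually_nhds_iff_ball.1
    (huc.and (hu.and (huψ.and hγφ)))
  rw [Real.ball_eq_Ioo] at hball
  refine ⟨ε, hε, fun t ↦ ψ.symm (u t), fun t ht ↦ ?_, by simp only [hu₀, ψ.left_inv hp],
    fun t ht ↦ ?_⟩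
  · obtain ⟨h1, -, h3, -⟩ := hball t ht
    exact ((ψ.continuousAt_symm h3).comp h1).continuousWithinAt
  · obtain ⟨-, h2, h3, h4⟩ := hball t ht
    -- Both points lie in `φ.source`, so equal coordinates mean equal points.
    exact φ.injOn (h.mapsTo (ψ.map_target h3)) h4 ((h.map_symm h3).trans h2)

omit [IsManifold 𝓘(ℝ, E') ∞ S] in
/-- If geodesics that start tangentially to the submanifold at `p` remain within it, then the
second fundamental form vanishes at `p`, in adapted charts. -/
lemma christoffel_mem_of_remainsWithinNear [T2Space M]
    (hcov : CovariantDerivative.ContMDiffCovariantDerivative cov ∞) {p : S} (hp : p ∈ ψ.source)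
    (H : ∀ (γ : ℝ → M) (J : Set ℝ) (t₀ : ℝ), IsOpen J → J.OrdConnected → t₀ ∈ J →
      IsGeodesicOn cov γ J → StartsTangentAt E E' f p γ t₀ → RemainsWithinNear f p γ t₀) (v : E') :
    christoffel cov φ (ι (ψ p)) (ι v) (ι v) ∈ range ι := by
  obtain ⟨x, y, ε, hε, hx₀, hy₀, hx, hxy⟩ := exists_geodesic_of_contDiffOn φ.open_target
    (contDiffOn_christoffel cov h.cod_mem hcov) (h.map_mem_target hp) (ι v) 0
  have h0 : (0 : ℝ) ∈ Ioo (0 - ε) (0 + ε) := by simpa using hε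
  obtain ⟨hgeo, hvel⟩ := isGeodesicOn_of_hasDerivAt cov h.cod_mem isOpen_Ioo hx hxy
  have hγ₀ : φ.symm (x 0) = f p := by
    rw [hx₀, ← h.eq_on hp, φ.left_inv (h.mapsTo hp)]
  have hst : StartsTangentAt E E' f p (fun t ↦ φ.symm (x t)) 0 := by
    refine ⟨chartField ψ v p, ?_⟩
    have hv := (h.chartVec_mfderiv hf hp (chartField ψ v p)).trans
      (congrArg ι (chartVec_chartField h.dom_mem hp v))
    rw [← hy₀, ← hvel 0 h0] at hv
    -- Stated on the total space because the two base points are only propositionally equal.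
    have key : ∀ (a b : TangentBundle 𝓘(ℝ, E) M), a.1 ∈ φ.source → a.1 = b.1 →
        chartVec φ a = chartVec φ b → a = b := by
      rintro ⟨a, u⟩ ⟨b, w⟩ ha (rfl : a = b) huw
      rw [← chartField_chartVec h.cod_mem ha u, ← chartField_chartVec h.cod_mem ha w, huw]
    exact key _ _ (φ.map_target (hxy 0 h0).1) hγ₀ hv.symm
  obtain ⟨δ, hδ, c, hc, hc₀, hfc⟩ := H _ _ 0 isOpen_Ioo ordConnected_Ioo h0 hgeo hst
  have h0' : Ioo (0 - δ) (0 + δ) ∈ 𝓝 (0 : ℝ) := isOpen_Ioo.mem_nhds (by simpa using hδ)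
  -- Continuity of `c` is essential here: it keeps `c` on the sheet through `p`, where `f` is `ι`,
  -- even if `f` is not injective.
  have hcψ : ∀ᶠ t in 𝓝 (0 : ℝ), c t ∈ ψ.source := (hc.continuousAt h0').eventually
    (ψ.open_source.mem_nhds (by rw [hc₀]; exact hp))
  -- `Q` cuts out `range ι`. It vanishes on the curve, hence on its velocity, hence on its
  -- acceleration `-Γ(ιv, ιv)` at time zero.
  let Q : E →L[ℝ] E := ContinuousLinearMap.id ℝ E - ι.comp P
  have hQr (z : E) : z ∈ range ι ↔ Q z = 0 := h.mem_range_iff z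
  have hIoo := isOpen_Ioo.mem_nhds h0
  have hQx : (fun t ↦ Q (x t)) =ᶠ[𝓝 0] fun _ ↦ 0 := by
    filter_upwards [h0', hcψ, hIoo] with t ht htψ ht'
    have h1 : φ (f (c t)) = x t := (congrArg φ (hfc t ht)).trans (φ.right_inv (hxy t ht').1)
    rw [← hQr, ← h1, h.eq_on htψ]
    exact mem_range_self _
  have hQy : (fun t ↦ Q (y t)) =ᶠ[𝓝 0] fun _ ↦ 0 := by
    filter_upwards [hQx.eventuallyEq_nhds, hIoo] with t ht ht'
    exact (Q.hasFDerivAt.comp_hasDerivAt t (hxy t ht').2.1).unique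
      ((hasDerivAt_const t (0 : E)).congr_of_eventuallyEq ht)
  have h2 := (Q.hasFDerivAt.comp_hasDerivAt (0 : ℝ) (hxy 0 h0).2.2).unique
    ((hasDerivAt_const (0 : ℝ) (0 : E)).congr_of_eventuallyEq hQy)
  rw [map_neg, neg_eq_zero, hx₀, hy₀] at h2
  exact (hQr _).2 h2

end AdaptedCharts

end Submanifolds

/-! ### The theorem -/

theorem mainTheorem2
    {E : Type*} [NormedAddCommGroup E] [NormedSpace ℝ E] [FiniteDimensional ℝ E]
    {M : Type*} [TopologicalSpace M] [ChartedSpace E M] [IsManifold 𝓘(ℝ, E) ∞ M] [T2Space M]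
    {E' : Type*} [NormedAddCommGroup E'] [NormedSpace ℝ E'] [FiniteDimensional ℝ E']
    {S : Type*} [TopologicalSpace S] [ChartedSpace E' S] [IsManifold 𝓘(ℝ, E') ∞ S] [T2Space S]
    (g : SemiRiemannianMetric E M)
    (cov : CovariantDerivative 𝓘(ℝ, E) E (TangentSpace 𝓘(ℝ, E) : M → Type _))
    (hcov : IsLeviCivita g cov)
    (f : S → M) (hf : IsImmersion 𝓘(ℝ, E') 𝓘(ℝ, E) ∞ f) :
    (IsTotallyUmbilic E' g cov f →
      ∀ (γ : ℝ → M) (J : Set ℝ) (t₀ : ℝ) (p : S), IsOpen J → J.OrdConnected → t₀ ∈ J →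
        IsGeodesicOn cov γ J → IsLightlikeOn g γ J → StartsTangentAt E E' f p γ t₀ →
        RemainsWithinNear f p γ t₀) ∧
    (IsTotallyGeodesic E' g cov f ↔
      ∀ (γ : ℝ → M) (J : Set ℝ) (t₀ : ℝ) (p : S), IsOpen J → J.OrdConnected → t₀ ∈ J →
        IsGeodesicOn cov γ J → StartsTangentAt E E' f p γ t₀ →
        RemainsWithinNear f p γ t₀) := by
  have hfs : ContMDiff 𝓘(ℝ, E') 𝓘(ℝ, E) ∞ f := hf.contMDiff
  refine ⟨?_, ?_, fun H ↦ ?_⟩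
  · rintro ⟨N, hN⟩ γ J t₀ p hJ - ht₀ hγ hlight hs
    obtain ⟨ψ, φ, ι, P, h, hp⟩ := exists_adaptedCharts hf p
    have hγφ : γ t₀ ∈ φ.source := by
      obtain ⟨v, hv⟩ := hs
      rw [show γ t₀ = f p from congrArg TotalSpace.proj hv]
      exact h.mapsTo hp
    refine h.remainsWithinNear cov hfs hcov.smooth hp
      (n := fun u ↦ chartVec φ ⟨f (ψ.symm u), N (ψ.symm u)⟩) ?_ (contDiffOn_chartMetric h.cod_mem)
      (fun z hz ↦ fderiv_chartMetric h.cod_mem hcov hz)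
      (fun u hu ↦ h.christoffel_sub_mem cov hfs hN hu) ?_ hJ ht₀ hγ hs
    · have h1 := ψ.continuousAt_symm (ψ.map_source hp)
      have h2 : ContinuousAt (fun q ↦ chartVec φ ⟨f q, N q⟩) (ψ.symm (ψ p)) := by
        rw [ψ.left_inv hp]
        exact ((contMDiffAt_chartVec h.cod_mem (v := ⟨f p, N p⟩) (h.mapsTo hp)).comp p
          hN.smooth.contMDiffAt).continuousAt
      exact h2.comp h1
    · rw [chartMetric_chartVec h.cod_mem hγφ]
      exact hlight t₀ ht₀
  · rintro ⟨N, hN, hN₀⟩ γ J t₀ p hJ - ht₀ hγ hs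
    obtain ⟨ψ, φ, ι, P, h, hp⟩ := exists_adaptedCharts hf p
    -- The zero form is parallel and makes every velocity null, so the null argument applies to all
    -- geodesics.
    refine h.remainsWithinNear cov hfs hcov.smooth hp (G := fun _ ↦ 0) (n := fun _ ↦ 0)
      continuousAt_const contDiffOn_const (fun z _ u v w ↦ by simp) (fun u hu v ↦ ?_) rfl
      hJ ht₀ hγ hs
    have h1 := h.christoffel_sub_mem cov hfs hN hu v
    -- Since `N` is tangential, the umbilic term already lies in `range ι` and can be dropped.
    have h2 : chartVec φ ⟨f (ψ.symm u), N (ψ.symm u)⟩ ∈ range ι :=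
      (h.mem_tangentImage hfs (ψ.map_target hu) _).1
        ((Submodule.Quotient.mk_eq_zero _).1 (hN₀ (ψ.symm u)))
    rw [smul_zero, sub_zero]
    exact ((LinearMap.range ι.toLinearMap).sub_mem_iff_left
      ((LinearMap.range ι.toLinearMap).smul_mem _ h2)).1 h1
  · refine ⟨fun q ↦ 0, ⟨?_, fun X Y _ hY p ↦ ?_⟩, fun q ↦ Submodule.Quotient.mk_zero _⟩
    · exact (contMDiff_zeroSection ℝ (TangentSpace 𝓘(ℝ, E) : M → Type _)).comp hfs
    obtain ⟨ψ, φ, ι, P, h, hp⟩ := exists_adaptedCharts hf p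
    have hΓ (v : E') : christoffel cov φ (ι (ψ p)) (ι v) (ι v) ∈ LinearMap.range ι.toLinearMap :=
      h.christoffel_mem_of_remainsWithinNear cov hfs hcov.smooth hp
        (fun γ J t₀ ↦ H γ J t₀ p) v
    rw [smul_zero, h.secondFundamentalForm_eq_mk_iff cov hfs hY hp]
    set v := chartVec ψ ⟨p, Y p⟩
    set w := chartVec ψ ⟨p, X p⟩
    have h0 : chartVec φ ⟨f p, 0⟩ = 0 := map_zero (mfderiv 𝓘(ℝ, E) 𝓘(ℝ, E) φ (f p))
    -- Polarization: by symmetry the difference is `2 Γ(ιv, ιw)`, whence the factor `2⁻¹` below.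
    have h1 := Submodule.sub_mem _ (Submodule.sub_mem _ (hΓ (v + w)) (hΓ v)) (hΓ w)
    have hsymm := christoffel_symm cov h.cod_mem hcov (h.map_mem_target hp) (ι w) (ι v)
    simp only [map_add, _root_.add_apply, hsymm] at h1
    rw [h0, sub_zero]
    obtain ⟨u, hu⟩ := Submodule.smul_mem _ (2⁻¹ : ℝ) h1
    refine ⟨u, hu.trans ?_⟩
    module

end
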